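/- **Setting.** An *infrastructure* of circumference $R>0$ is a finite set $X$ with an injective map $d:X\to\mathbb R/R\mathbb Z$ and an element $x_0$ with $d(x_0)=0$. Let $d_x\in[0,R)$ be the representative of $d(x)$. Let $\Delta_{bs}(x)=\min\{r>0: d(x)+r\in d(X)\}$ and $\Delta_{gs}(x,y)=\min\{r\ge 0: d(x)+d(y)+r\in d(X)\}$, and let the baby step $bs(x)$ and the giant step $gs(x,y)$ be the elements with $d(bs(x))=d(x)+\Delta_{bs}(x)$ and $d(gs(x,y))=d(x)+d(y)+\Delta_{gs}(x,y)$. Put $d_{\min}=\min_x\Delta_{bs}(x)$. An *$f$-representation* of a point $t\in\mathbb R/R\mathbb Z$ is the pair $(y,f)\in X\times\mathbb R$ with $0\le f<\Delta_{bs}(y)$ and $d(y)+f=t$. Given are a positive integer $\bar k$ and a real $d_{\bar k}>0$ such that $\sum_{i<\bar k}\Delta_{bs}(bs^i(y))\ge d_{\bar k}$ for all $y\in X$; and, for a precision $m$, approximations $\tilde\Delta_{bs},\tilde\Delta_{gs}$ of $\Delta_{bs},\Delta_{gs}$ with errors less than $2^{-m}$. Pairs $(y,f)$ are added approximately by $(y,f)+(y',f')\mapsto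 (gs(y,y'),f+f'-\tilde\Delta_{gs}(y,y'))$ followed by baby steps or inverse baby steps (with $f$ updated by $\tilde\Delta_{bs}$) until $0\le f<\tilde\Delta_{bs}(y)$. For $r\ge0$, $\tilde h(r)$ is obtained from $a\cdot(bs^{\bar k}(x_0),0)$, computed by doubling and adding, by adding $r-a\tilde D$ to the second component and reducing in the same way; here $\tilde D=\max\bigl(d_{\bar k},\sum_{i<\bar k}\tilde\Delta_{bs}(bs^i(x_0))\bigr)$ and $a$ is the integer nearest to $r/\tilde D$. Put $\tilde g(a,r)=a\cdot(x,0)+\tilde h(r)$, computed in this approximate arithmetic (an approximation of the $f$-representation of $a\,d(x)+r$). **Algorithm** (input $x\in X$, parameter $p\in[0,1)$). 1. Choose an integer $M\ge 2R+1$. 2. Take $\hat R$ with $|R-\hat R|\le \frac1{16M^2\lceil 2/d_{\min}\rceil}$, and $N=q\lceil 2/d_{\min}\rceil$ with an integer $1\le q\le 4M$ such that $B=\lfloor\hat RN\rceil$ (nearest integer) satisfies $|MB-MRN|\le\frac12$. Put $A=MB$. 3. Put $L=\Bigl\lceil \frac{2A\bar k\lceil\hat R/d_{\bar k}\rceil}{1-p}\Bigr\rceil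 N$, and choose $j\in\{0,\dots,L/N-1\}$ uniformly at random. 4. Prepare twice, with the same $j$, the uniform superposition of $|a\rangle|b\rangle|g_N(a,b)\rangle$ over $0\le a\le A-1$, $0\le b\le B-2$, where $g_N(a,b)=(\tilde y,\lfloor\tilde fN\rfloor)$ with $(\tilde y,\tilde f)=\tilde g(a,\frac bN+\frac jL)$. 5. Apply to each the quantum Fourier transform over $\mathbb Z_A\times\mathbb Z_B$ and measure, obtaining $(h_1,k_1)$, $(h_2,k_2)$. 6. If $\gcd(k_1,k_2)\ne1$, fail. Otherwise find $s,t$ with $sk_1+tk_2=1$ by the extended Euclidean algorithm. 7. Let $r=\frac{sh_1+th_2}{NM}$. 8. Let $r'=r-\lfloor r/\hat R\rfloor\hat R$ and return the integer $\hat d_x$ nearest to $r'$. A run *succeeds* if it does not fail and both $v=\hat d_x$ and $v=r'$ satisfy: $v$ is within distance $1$ of $d(x)$ on the circle $\mathbb R/R\mathbb Z$, and moreover $|d_x-v|\le1$ if $1\le d_x\le R-1$. Let $p_g$ be the probability (over $j$) that $g_N$ is evaluated correctly, i.e. that for all $a,b$ as in step 4, $g_N(a,b)=(y,\lfloor fN\rfloor)$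 where $(y,f)$ is the $f$-representation of $a\,d(x)+\frac bN+\frac jL$. Let $\operatorname{sinc}(\delta)=\frac{\sin\pi\delta}{\pi\delta}$. **Theorem.** There are absolute constants $C\in\mathbb N$ and $c>0$ such that for every infrastructure with at least $3$ elements the following hold. For every $M$ and $\hat R$ as in steps 1 and 2, an admissible $q$ in step 2 exists. For all admissible choices of $M,\hat R,q,\bar k,d_{\bar k},p$, all $m$ with $2^m\ge L^C$, all approximations $\tilde\Delta_{bs},\tilde\Delta_{gs}$ of precision $m$, and all $x\in X$: $p_g\ge p$; the success probability is at least $c\,p_g$ (so it is $\Omega(1)$ for fixed $p>0$); and it is at least $$p_g\left(1-\frac{2}{(2q+1)(1-\kappa)}\right)^2\frac{\kappa^2}{2}\left(1-2\sin\frac{\pi}{32}-\frac{1-\operatorname{sinc}(3/4)}{\kappa}\right)^4\left(\frac1{64}-\frac2B\right)^2$$ for every real $\kappa$ with $\frac{1-\operatorname{sinc}(3/4)}{1-2\sin(\pi/32)}<\kappa<1-\frac{2}{2q+1}$, hence at least the maximum of this expression over such $\kappa$. -/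

import Mathlib

universe u

/-- A (one-dimensional) infrastructure of circumference `R`: a finite set `X` with an injective
distance function into the circle `ℝ / Rℤ`, normalised by an element `x₀` of distance `0`. -/
structure Infrastructure (X : Type u) [Finite X] where
  /-- the circumference -/
  R : ℝ
  R_pos : 0 < R
  /-- the distance function -/
  d : X → AddCircle R
  d_injective : Function.Injective d
  /-- the base point -/
  x₀ : X
  d_x₀ : d x₀ = 0

namespace Infrastructure

variable {X : Type u} [Finite X] (I : Infrastructure X)

instance factRPos : Fact (0 < I.R) := ⟨I.R_pos⟩

/-! ### Baby steps and giant steps -/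

/-- `S_x = {r > 0 | d(x) + r mod R ∈ d(X)}`. -/
def babySet (x : X) : Set ℝ :=
  {r | 0 < r ∧ I.d x + (r : AddCircle I.R) ∈ Set.range I.d}

/-- `S_{x,y} = {r ≥ 0 | d(x) + d(y) + r mod R ∈ d(X)}`. -/
def giantSet (x y : X) : Set ℝ :=
  {r | 0 ≤ r ∧ I.d x + I.d y + (r : AddCircle I.R) ∈ Set.range I.d}

/-- The relative distance `Δ_bs(x) = min S_x`. -/
noncomputable def babyDist (x : X) : ℝ := sInf (I.babySet x)

/-- The relative distance `Δ_gs(x,y) = min S_{x,y}`. -/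
noncomputable def giantDist (x y : X) : ℝ := sInf (I.giantSet x y)

theorem babyDist_isLeast (x : X) : IsLeast (I.babySet x) (I.babyDist x) := by
  have : Nonempty X := ⟨I.x₀⟩
  obtain ⟨y, hy⟩ := Finite.exists_min
    (fun y : X => (AddCircle.equivIoc I.R 0 (I.d y - I.d x) : ℝ))
  have hleast : IsLeast (I.babySet x) (AddCircle.equivIoc I.R 0 (I.d y - I.d x) : ℝ) := by
    refine ⟨⟨(AddCircle.equivIoc I.R 0 (I.d y - I.d x)).2.1, y, ?_⟩, ?_⟩
    · rw [AddCircle.coe_equivIoc]; abel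
    · rintro r ⟨hr, z, hz⟩
      refine (hy z).trans ?_
      have h1 : I.d z - I.d x = (r : AddCircle I.R) := by rw [hz]; abel
      by_cases hrR : r ≤ I.R
      · have hmem : r ∈ Set.Ioc (0 : ℝ) (0 + I.R) := ⟨hr, by simpa using hrR⟩
        simp only [h1]
        rw [AddCircle.equivIoc_coe_eq hmem]
      · have h2 := (AddCircle.equivIoc I.R 0 (I.d z - I.d x)).2.2
        exact h2.trans (by linarith [not_le.1 hrR])
  have := hleast.csInf_eq
  unfold babyDist
  rw [this]
  exact hleast

theorem giantDist_isLeast (x y : X) : IsLeast (I.giantSet x y) (I.giantDist x y) := by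
  have : Nonempty X := ⟨I.x₀⟩
  obtain ⟨z, hz⟩ := Finite.exists_min
    (fun z : X => (AddCircle.equivIco I.R 0 (I.d z - (I.d x + I.d y)) : ℝ))
  have hleast : IsLeast (I.giantSet x y)
      (AddCircle.equivIco I.R 0 (I.d z - (I.d x + I.d y)) : ℝ) := by
    refine ⟨⟨(AddCircle.equivIco I.R 0 (I.d z - (I.d x + I.d y))).2.1, z, ?_⟩, ?_⟩
    · rw [AddCircle.coe_equivIco]; abel
    · rintro r ⟨hr, w, hw⟩
      refine (hz w).trans ?_
      have h1 : I.d w - (I.d x + I.d y) = (r : AddCircle I.R) := by rw [hw]; abel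
      by_cases hrR : r < I.R
      · have hmem : r ∈ Set.Ico (0 : ℝ) (0 + I.R) := ⟨hr, by simpa using hrR⟩
        simp only [h1]
        rw [AddCircle.equivIco_coe_eq hmem]
      · have h2 := (AddCircle.equivIco I.R 0 (I.d w - (I.d x + I.d y))).2.2
        exact h2.le.trans (by linarith [not_lt.1 hrR])
  have := hleast.csInf_eq
  unfold giantDist
  rw [this]
  exact hleast

theorem exists_babyStep (x : X) :
    ∃ z, I.d z = I.d x + (I.babyDist x : AddCircle I.R) :=
  (I.babyDist_isLeast x).1.2

theorem exists_giantStep (x y : X) :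
    ∃ z, I.d z = I.d x + I.d y + (I.giantDist x y : AddCircle I.R) :=
  (I.giantDist_isLeast x y).1.2

/-- The baby step: `d(bs(x)) = d(x) + Δ_bs(x) mod R`. -/
noncomputable def bs (x : X) : X := (I.exists_babyStep x).choose

/-- The giant step: `d(gs(x,y)) = d(x) + d(y) + Δ_gs(x,y) mod R`. -/
noncomputable def gs (x y : X) : X := (I.exists_giantStep x y).choose

theorem d_bs (x : X) : I.d (I.bs x) = I.d x + (I.babyDist x : AddCircle I.R) :=
  (I.exists_babyStep x).choose_spec

theorem d_gs (x y : X) :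
    I.d (I.gs x y) = I.d x + I.d y + (I.giantDist x y : AddCircle I.R) :=
  (I.exists_giantStep x y).choose_spec

theorem bs_bijective : Function.Bijective I.bs := by
  refine Finite.injective_iff_bijective.1 ?_
  have key : ∀ x y, I.bs x = I.bs y → ¬ I.babyDist x < I.babyDist y := by
    intro x y h hlt
    have hd := I.d_bs x
    rw [h, I.d_bs y] at hd
    have hmem : I.babyDist y - I.babyDist x ∈ I.babySet y := by
      refine ⟨sub_pos.2 hlt, x, ?_⟩
      rw [AddCircle.coe_sub, ← add_sub_assoc, hd, add_sub_cancel_right]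
    have h1 := (I.babyDist_isLeast y).2 hmem
    have h2 := (I.babyDist_isLeast x).1.1
    linarith
  intro x y h
  have he : I.babyDist x = I.babyDist y :=
    le_antisymm (not_lt.1 (key y x h.symm)) (not_lt.1 (key x y h))
  have hd := I.d_bs x
  rw [h, I.d_bs y, he] at hd
  exact (I.d_injective (add_right_cancel hd)).symm

/-- The inverse baby step `bs⁻¹`. -/
noncomputable def bsInv (x : X) : X := (Equiv.ofBijective I.bs I.bs_bijective).symm x

/-- `d_min = min_x Δ_bs(x)` (a minimum over a finite non-empty set). -/
noncomputable def dmin : ℝ := ⨅ x, I.babyDist x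

/-- The distance `d_x` of `x` as a real number in `[0, R)`. -/
noncomputable def dist (x : X) : ℝ := (AddCircle.equivIco I.R 0 (I.d x) : ℝ)

/-- Any `k` consecutive elements span a distance of at least `dk`. -/
def SpansAtLeast (k : ℕ) (dk : ℝ) : Prop :=
  0 < k ∧ 0 < dk ∧ ∀ x, dk ≤ ∑ i ∈ Finset.range k, I.babyDist (I.bs^[i] x)

/-! ### Approximate arithmetic in the circle group -/

/-- Approximate relative distances, with errors smaller than `2⁻ᵐ`. -/
structure ApproxDist (m : ℕ) where
  /-- the computed approximation of `Δ_bs` -/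
  baby : X → ℝ
  /-- the computed approximation of `Δ_gs` -/
  giant : X → X → ℝ
  baby_lt : ∀ x, |I.babyDist x - baby x| < 1 / 2 ^ m
  giant_lt : ∀ x y, |I.giantDist x y - giant x y| < 1 / 2 ^ m

/-- `p = (y, f)` is the (exact) `f`-representation of the point `t` of the circle:
`0 ≤ f < Δ_bs(y)` and `d(y) + f = t mod R`. -/
def IsFRep (p : X × ℝ) (t : AddCircle I.R) : Prop :=
  0 ≤ p.2 ∧ p.2 < I.babyDist p.1 ∧ I.d p.1 + (p.2 : AddCircle I.R) = t

namespace ApproxDist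

variable {I} {m : ℕ} (D : I.ApproxDist m)

/-- `(x, f)` looks like an `f`-representation, judged by the approximate distances. -/
def IsReduced (p : X × ℝ) : Prop := 0 ≤ p.2 ∧ p.2 < D.baby p.1

open Classical in
/-- One step of the reduction: an inverse baby step if `f` is negative, a baby step if `f` is
too large. -/
noncomputable def reduceStep (p : X × ℝ) : X × ℝ :=
  if p.2 < 0 then (I.bsInv p.1, p.2 + D.baby (I.bsInv p.1))
  else if D.baby p.1 ≤ p.2 then (I.bs p.1, p.2 - D.baby p.1)
  else p

open Classical in
/-- The loop: apply reduction steps until the pair is reduced. -/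
noncomputable def reduce (p : X × ℝ) : X × ℝ :=
  if h : ∃ n : ℕ, D.IsReduced (D.reduceStep^[n] p) then D.reduceStep^[Nat.find h] p else p

/-- Approximate addition of pairs: a giant step followed by reduction. -/
noncomputable def add (p p' : X × ℝ) : X × ℝ :=
  D.reduce (I.gs p.1 p'.1, p.2 + p'.2 - D.giant p.1 p'.1)

/-- Approximate multiples `a · p` by doubling and adding, along the binary digits of `a`. -/
noncomputable def nsmul (a : ℕ) (p : X × ℝ) : X × ℝ :=
  if a = 0 then (I.x₀, 0)
  else if a % 2 = 1 then D.add p (nsmul (a / 2) (D.add p p))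
  else nsmul (a / 2) (D.add p p)
termination_by a
decreasing_by all_goals omega

/-- The computed distance of `x_k = bsᵏ(x₀)`; it is replaced by the known lower bound `dk` if it
comes out smaller than that. -/
noncomputable def farDist (k : ℕ) (dk : ℝ) : ℝ :=
  max dk (∑ i ∈ Finset.range k, D.baby (I.bs^[i] I.x₀))

/-- The approximate version `h̃(r)` of the homomorphism `ℝ → ℝ/Rℤ`: a multiple of `x_k` is
computed that comes close to `r`, and baby steps do the rest. -/
noncomputable def hApprox (k : ℕ) (dk : ℝ) (r : ℝ) : X × ℝ :=
  let a : ℕ := (round (r / D.farDist k dk)).toNat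
  let p := D.nsmul a (I.bs^[k] I.x₀, 0)
  D.reduce (p.1, p.2 + (r - a * D.farDist k dk))

/-- The approximate version `g̃(a, r)` of the homomorphism `(a, r) ↦ a · (x, 0) + h(r)`. -/
noncomputable def gApprox (k : ℕ) (dk : ℝ) (x : X) (a : ℕ) (r : ℝ) : X × ℝ :=
  D.add (D.nsmul a (x, 0)) (D.hApprox k dk r)

/-- The quantized function `g_N(a, b) = (ỹ, ⌊f̃ N⌋)` with `(ỹ, f̃) = g̃(a, b/N + j/L)`. -/
noncomputable def gN (k : ℕ) (dk : ℝ) (x : X) (N L j : ℕ) (a b : ℕ) : X × ℤ :=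
  let p := D.gApprox k dk x a (b / N + j / L)
  (p.1, ⌊p.2 * N⌋)

end ApproxDist

/-! ### The parameters of the algorithm -/

/-- `⌈2 / d_min⌉`. -/
noncomputable def cmin : ℕ := ⌈2 / I.dmin⌉₊

/-- `N = q ⌈2 / d_min⌉`. -/
noncomputable def paramN (q : ℕ) : ℕ := q * I.cmin

/-- `B = ⌊R̂ N⌉`. -/
noncomputable def paramB (q : ℕ) (Rhat : ℝ) : ℕ := (round (Rhat * I.paramN q)).toNat

/-- `A = M B`. -/
noncomputable def paramA (M q : ℕ) (Rhat : ℝ) : ℕ := M * I.paramB q Rhat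

/-- The number `L / N = ⌈2 A k ⌈R̂ / dk⌉ / (1 - p)⌉` of possible offsets. -/
noncomputable def paramJ (M q : ℕ) (Rhat : ℝ) (k : ℕ) (dk p : ℝ) : ℕ :=
  ⌈2 * (I.paramA M q Rhat : ℝ) * k * (⌈Rhat / dk⌉ : ℝ) / (1 - p)⌉₊

/-- `L = ⌈2 A k ⌈R̂ / dk⌉ / (1 - p)⌉ N`. -/
noncomputable def paramL (M q : ℕ) (Rhat : ℝ) (k : ℕ) (dk p : ℝ) : ℕ :=
  I.paramJ M q Rhat k dk p * I.paramN q

/-- `M` is large enough, and `R̂` is an estimate of `R` of the required precision. -/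
structure GoodEstimate (M : ℕ) (Rhat : ℝ) : Prop where
  hM : 2 * I.R + 1 ≤ M
  hR : |I.R - Rhat| ≤ 1 / (16 * (M : ℝ) ^ 2 * I.cmin)

/-- `q` is an admissible choice in the second step of the algorithm. -/
structure GoodMultiplier (M q : ℕ) (Rhat : ℝ) : Prop where
  pos : 0 < q
  le : q ≤ 4 * M
  near : |(M : ℝ) * I.paramB q Rhat - M * I.R * I.paramN q| ≤ 1 / 2

end Infrastructure

/-! ### Fourier sampling -/

open Classical in
/-- The superposition `(A(B-1))^{-1/2} ∑ₐ ∑_{b ≤ B-2} |a⟩|b⟩|g(a,b)⟩`, as amplitudes on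
`ℤ_A × ℤ_B × Z`. -/
noncomputable def fibreState {Z : Type u} (A B : ℕ) (g : ℕ → ℕ → Z) :
    Fin A × Fin B → Z → ℂ :=
  fun ab z => if (ab.2 : ℕ) < B - 1 ∧ g ab.1 ab.2 = z
    then 1 / (Real.sqrt ((A : ℝ) * (B - 1 : ℕ)) : ℂ) else 0

/-- The quantum Fourier transform over `ℤ_A × ℤ_B`, applied to the first two registers. -/
noncomputable def fourierTransform {Z : Type u} (A B : ℕ) (ψ : Fin A × Fin B → Z → ℂ) :
    Fin A × Fin B → Z → ℂ :=
  fun hk z => 1 / (Real.sqrt ((A : ℝ) * B) : ℂ) *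
    ∑ ab : Fin A × Fin B,
      Complex.exp (2 * Real.pi * Complex.I * ((ab.1 : ℕ) * (hk.1 : ℕ) / A)) *
      Complex.exp (2 * Real.pi * Complex.I * ((ab.2 : ℕ) * (hk.2 : ℕ) / B)) * ψ ab z

/-- The probability that all registers of the Fourier transform of the superposition are measured
and the first two show `(h, k)`, whatever the third one shows. -/
noncomputable def sampleProb {Z : Type u} (A B : ℕ) (g : ℕ → ℕ → Z) (hk : Fin A × Fin B) : ℝ :=
  ∑' z : Z, ‖fourierTransform A B (fibreState A B g) hk z‖ ^ 2

/-! ### Classical post-processing and the success probability -/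

/-- `r - ⌊r / R̂⌋ R̂` with `r = (s h₁ + t h₂) / (N M)`, where `s`, `t` are the coefficients that the
extended Euclidean algorithm finds for `k₁`, `k₂`. -/
noncomputable def postProcess (N M : ℕ) (Rhat : ℝ) (h₁ k₁ h₂ k₂ : ℕ) : ℝ :=
  let r : ℝ := (Nat.gcdA k₁ k₂ * h₁ + Nat.gcdB k₁ k₂ * h₂) / (N * M)
  r - ⌊r / Rhat⌋ * Rhat

namespace Infrastructure

variable {X : Type u} [Finite X] (I : Infrastructure X)

/-- `v` is within `1` of the distance of `x` on the circle `ℝ/Rℤ`, and also as a real number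
unless `d_x` is so close to an end of `[0, R)` that wrapping around is possible. -/
def IsCloseTo (x : X) (v : ℝ) : Prop :=
  ‖(v : AddCircle I.R) - I.d x‖ ≤ 1 ∧ (1 ≤ I.dist x → I.dist x ≤ I.R - 1 → |I.dist x - v| ≤ 1)

/-- The two samples make the algorithm succeed: `s k₁ + t k₂ = 1` is solvable, and both the
number `r - ⌊r/R̂⌋R̂` and the nearest integer to it are correct up to an error of at most `1`. -/
def Succeeds (x : X) (N M : ℕ) (Rhat : ℝ) (h₁ k₁ h₂ k₂ : ℕ) : Prop :=
  Nat.Coprime k₁ k₂ ∧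
  I.IsCloseTo x (postProcess N M Rhat h₁ k₁ h₂ k₂) ∧
  I.IsCloseTo x (round (postProcess N M Rhat h₁ k₁ h₂ k₂) : ℤ)

/-- The function `g_N` computed for the offset `j/L` is correct on the whole domain of the
superposition: it agrees with the quantization of the exact homomorphism
`(a, r) ↦ a · (x, 0) + h(r)`. -/
def EvaluatesCorrectly (x : X) (A B N L j : ℕ) (g : ℕ → ℕ → X × ℤ) : Prop :=
  ∀ a < A, ∀ b < B - 1, ∃ p : X × ℝ,
    I.IsFRep p (a • I.d x + (((b : ℝ) / N + (j : ℝ) / L : ℝ) : AddCircle I.R)) ∧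
    g a b = (p.1, ⌊p.2 * N⌋)

variable {I} {m : ℕ} (D : I.ApproxDist m)

open Classical in
/-- The probability, over the uniformly random offset `j ∈ {0, …, L/N - 1}`, that `g_N` is
evaluated correctly. -/
noncomputable def ApproxDist.evalProb (k : ℕ) (dk p : ℝ) (M q : ℕ) (Rhat : ℝ) (x : X) : ℝ :=
  let N := I.paramN q
  let B := I.paramB q Rhat
  let A := I.paramA M q Rhat
  let J := I.paramJ M q Rhat k dk p
  let L := I.paramL M q Rhat k dk p
  1 / (J : ℝ) * ∑ j ∈ Finset.range J,
    if I.EvaluatesCorrectly x A B N L j (D.gN k dk x N L j) then 1 else 0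

open Classical in
/-- The success probability of the algorithm: a uniformly random offset `j`, then two independent
rounds of Fourier sampling with this offset, then the post-processing. -/
noncomputable def ApproxDist.successProb (k : ℕ) (dk p : ℝ) (M q : ℕ) (Rhat : ℝ) (x : X) : ℝ :=
  let N := I.paramN q
  let B := I.paramB q Rhat
  let A := I.paramA M q Rhat
  let J := I.paramJ M q Rhat k dk p
  let L := I.paramL M q Rhat k dk p
  1 / (J : ℝ) * ∑ j ∈ Finset.range J,
    ∑ hk₁ : Fin A × Fin B, ∑ hk₂ : Fin A × Fin B,
      if I.Succeeds x N M Rhat hk₁.1 hk₁.2 hk₂.1 hk₂.2 then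
        sampleProb A B (D.gN k dk x N L j) hk₁ * sampleProb A B (D.gN k dk x N L j) hk₂
      else 0

end Infrastructure

/-- The normalised `sinc`: `sin(πδ)/(πδ)`. -/
noncomputable def nsinc (δ : ℝ) : ℝ := Real.sinc (Real.pi * δ)

/-- The factor of the lower bound on the success probability that depends on `κ`, `q` and `B`. -/
noncomputable def dlogBound (κ : ℝ) (q B : ℕ) : ℝ :=
  (1 - 2 / ((2 * q + 1) * (1 - κ))) ^ 2 * (κ ^ 2 / 2) *
    (1 - 2 * Real.sin (Real.pi / 32) - (1 - nsinc (3 / 4)) / κ) ^ 4 *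
    (1 / 64 - 2 / (B : ℝ)) ^ 2

/-!
The proof has two independent halves, one about the approximate arithmetic and one about Fourier
sampling.

*Correctness of the evaluation.* Every reduction step and every addition perturbs the represented
point of the circle by at most a multiple of `2⁻ᵐ`, and doubling and adding multiplies errors by at
most `a`; so if `2ᵐ ≥ L⁵` the total error stays below `1/(2L)` (`gApprox_spec`, `error_lt`). The
quantized value can then be wrong only if the point `a d(x) + b/N + j/L` is that close to a cell
boundary `d(y) + i/N`. Modulo `1/N` neither `b` nor `i` matters, so for given `a` and `y`, and given
whether the boundary lies beyond the end of the interval `[0, R)`, at most one `j` is bad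
(`exists_near_of_not_evaluatesCorrectly`, `card_filter_near_lattice_le_one`). Altogether at most
`2A|X| ≤ 2Ak⌈R̂/dk⌉` of the `L/N` offsets are bad, which is the fraction `1 - p`.

*Sampling.* For a correct offset, fix a fibre of `g_N`, that is, a cell of the circle. It contains
at most one `b` for every `a`, and there, up to a multiple of `B`, `b` equals an affine function of
`a` with slope `-B d_x / R`, up to an error confined to an interval of length `1.3`. So the
amplitude at `(h, k)` is a sum over the fibre of unit vectors with angles
`2π (a (h - θ) / A + k · O(1) / B)`, where `θ = A k d_x / R`. If `θ` is within `1/4` of an integer,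
then for `h` congruent to this integer the angles lie in a sector of less than a half turn, provided
that `k ≤ B/6`. Otherwise the amplitudes at the two integers around `θ` are combined: with suitable
unit coefficients their difference is the same sum with weights `2 sin (π (a + 1/2) / A) ≥ 0` and
with the mean of the two deviations, which is at most `1/4`. Either way the outcomes near `θ` get
a weight of order `n⁴/A²` from a fibre with `n` elements. There are at most `2(B - 1)` cells for
`A(B - 1)` points, so by the power mean inequality the outcomes near `θ` have total probability
`Ω(1/B)` for each `k ≤ B/6` (`IsQuantizedHom.le_sum_sampleProb`). No fibre has to be singled
out as large.

At least half of the pairs in `[1, K]²` are coprime (`sq_le_two_mul_card_coprime`), and two outcomes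
near their targets with coprime `k₁, k₂ ≤ B/6` determine `d_x` up to `2/5`
(`succeeds_of_nearTarget`), because the Bézout coefficients are bounded by `B/6` as well. With
`K = ⌊B/6⌋` this gives a constant success probability for all `q`.

*The explicit bound.* The admissible range of `κ` is non-empty only for `q ≥ 8`, hence `B ≥ 48`, and
there the expression is at most `5 · 10⁻⁸` (`dlogBound_le`). The argument above with `K = ⌊B/16⌋`
and sectors of angle `2π/3` shows a success probability of more than `2 · 10⁻⁷`.
-/

/-! ### Bézout coefficients and coprime pairs -/

theorem Nat.xgcdAux_linear (x y : ℕ) : ∀ s t s' t' : ℤ,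
    (Nat.xgcdAux x s t y s' t').2 =
      (Nat.gcdA x y * s + Nat.gcdB x y * s', Nat.gcdA x y * t + Nat.gcdB x y * t') := by
  induction x, y using Nat.gcd.induction with
  | H0 y => intro s t s' t'; simp [Nat.xgcd_zero_left]
  | H1 x y h IH =>
    intro s t s' t'
    have hA : (Nat.gcdA x y, Nat.gcdB x y) = (Nat.xgcdAux x 1 0 y 0 1).2 := rfl
    rw [Nat.xgcdAux_rec h, IH] at hA
    obtain ⟨h1, h2⟩ := Prod.mk.inj hA
    rw [Nat.xgcdAux_rec h, IH, h1, h2]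
    ext <;> simp only <;> ring

theorem Nat.gcdA_gcdB_rec {x : ℕ} (y : ℕ) (h : 0 < x) :
    Nat.gcdA x y = Nat.gcdB (y % x) x - (y / x : ℕ) * Nat.gcdA (y % x) x ∧
      Nat.gcdB x y = Nat.gcdA (y % x) x := by
  have hA : (Nat.gcdA x y, Nat.gcdB x y) = (Nat.xgcdAux x 1 0 y 0 1).2 := rfl
  rw [Nat.xgcdAux_rec h, Nat.xgcdAux_linear] at hA
  obtain ⟨h1, h2⟩ := Prod.mk.inj hA
  rw [h1, h2]
  constructor
  · push_cast; ring
  · ring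

/-- The coefficients found by the extended Euclidean algorithm do not exceed its arguments. -/
theorem Nat.abs_gcdA_le_and_abs_gcdB_le (x y : ℕ) (hy : 0 < y) :
    |Nat.gcdA x y| ≤ y ∧ |Nat.gcdB x y| ≤ max x 1 := by
  induction x, y using Nat.gcd.induction with
  | H0 y => simp
  | H1 x y h IH =>
    obtain ⟨h1, h2⟩ := IH h
    obtain ⟨h3, h4⟩ := Nat.gcdA_gcdB_rec y h
    rw [h3, h4]
    refine ⟨?_, h1.trans (by simp)⟩
    have hdiv : ((y % x : ℕ) : ℤ) + x * (y / x : ℕ) = y := by exact_mod_cast Nat.mod_add_div y x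
    rcases Nat.eq_zero_or_pos (y % x) with h0 | h0
    · rw [h0]; simp only [Nat.gcdA_zero_left, Nat.gcdB_zero_left]
      simp only [mul_zero, sub_zero, abs_one]; exact_mod_cast hy
    · rw [max_eq_left h0] at h2
      calc _ ≤ |Nat.gcdB (y % x) x| + |((y / x : ℕ) : ℤ) * Nat.gcdA (y % x) x| := abs_sub _ _
        _ ≤ (y % x : ℕ) + (y / x : ℕ) * x := by
            rw [abs_mul, Nat.abs_cast]; gcongr
        _ = y := by rw [← hdiv]; ring

/-- Telescoping bound for `∑ 1/d²` over odd `d ≥ 3`. -/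
theorem sum_one_div_odd_sq_le (K : ℕ) :
    ∑ i ∈ Finset.range K, 1 / ((2 * i + 3 : ℕ) : ℝ) ^ 2 ≤ 1 / 4 := by
  have h : ∀ K : ℕ, ∑ i ∈ Finset.range K, 1 / ((2 * i + 3 : ℕ) : ℝ) ^ 2
      ≤ 1 / 4 - 1 / (4 * ((K : ℝ) + 1)) := by
    intro K
    induction K with
    | zero => simp
    | succ K ih =>
      rw [Finset.sum_range_succ]
      have : 1 / ((2 * K + 3 : ℕ) : ℝ) ^ 2 ≤ 1 / (4 * (K + 1)) - 1 / (4 * ((K + 1 : ℕ) + 1)) := by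
        push_cast
        rw [div_sub_div _ _ (by positivity) (by positivity), div_le_div_iff₀ (by positivity)
          (by positivity)]
        nlinarith [Nat.cast_nonneg (α := ℝ) K]
      linarith
  refine (h K).trans ?_
  have : (0 : ℝ) ≤ 1 / (4 * ((K : ℝ) + 1)) := by positivity
  linarith

/-- At least half of the pairs in `[1, K]²` are coprime: a common prime factor is `2` or odd. -/
theorem sq_le_two_mul_card_coprime (K : ℕ) :
    (K : ℝ) ^ 2 ≤ 2 * (((Finset.Icc 1 K ×ˢ Finset.Icc 1 K).filter
      fun p => Nat.Coprime p.1 p.2).card : ℝ) := by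
  classical
  set S := Finset.Icc 1 K ×ˢ Finset.Icc 1 K
  let m : ℕ → Finset ℕ := fun d => (Finset.Icc 1 K).filter (d ∣ ·)
  have hm : ∀ d, 0 < d → ((m d).card : ℝ) ≤ K / d := by
    intro d hd
    have : (m d).card = K / d := by
      rw [← Nat.Ioc_filter_dvd_card_eq_div]; rfl
    rw [this]; exact Nat.cast_div_le
  have hcov : S.filter (fun p => ¬ Nat.Coprime p.1 p.2) ⊆
      (m 2 ×ˢ m 2) ∪ (Finset.range K).biUnion fun i => m (2 * i + 3) ×ˢ m (2 * i + 3) := by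
    rintro ⟨a, b⟩ h
    simp only [S, Finset.mem_filter, Finset.mem_product, Finset.mem_Icc] at h
    obtain ⟨⟨⟨ha1, ha2⟩, hb1, hb2⟩, hc⟩ := h
    obtain ⟨p, hp, hpa, hpb⟩ := Nat.Prime.not_coprime_iff_dvd.1 hc
    rcases hp.eq_two_or_odd with rfl | hodd
    · apply Finset.mem_union_left
      simp [m, ha1, ha2, hb1, hb2, hpa, hpb]
    · apply Finset.mem_union_right
      have h2 := hp.two_le
      have hpK := (Nat.le_of_dvd ha1 hpa).trans ha2
      rw [Finset.mem_biUnion]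
      refine ⟨(p - 3) / 2, Finset.mem_range.2 (by omega), ?_⟩
      have : 2 * ((p - 3) / 2) + 3 = p := by omega
      simp [m, ha1, ha2, hb1, hb2, hpa, hpb, this]
  have hsq : ∀ d, 0 < d → ((m d ×ˢ m d).card : ℝ) ≤ K ^ 2 * (1 / (d : ℝ) ^ 2) := by
    intro d hd
    rw [Finset.card_product, Nat.cast_mul]
    calc _ ≤ (K / d : ℝ) * (K / d) := by gcongr <;> exact hm d hd
      _ = _ := by ring
  have hbad : ((S.filter (fun p => ¬ Nat.Coprime p.1 p.2)).card : ℝ) ≤ K ^ 2 / 2 := by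
    calc _ ≤ (((m 2 ×ˢ m 2) ∪ (Finset.range K).biUnion
            fun i => m (2 * i + 3) ×ˢ m (2 * i + 3)).card : ℝ) := by
          exact_mod_cast Finset.card_le_card hcov
      _ ≤ ((m 2 ×ˢ m 2).card : ℝ) +
            ∑ i ∈ Finset.range K, ((m (2 * i + 3) ×ˢ m (2 * i + 3)).card : ℝ) := by
          exact_mod_cast (Finset.card_union_le _ _).trans
            (Nat.add_le_add_left Finset.card_biUnion_le _)
      _ ≤ K ^ 2 * (1 / ((2 : ℕ) : ℝ) ^ 2) +
            ∑ i ∈ Finset.range K, K ^ 2 * (1 / ((2 * i + 3 : ℕ) : ℝ) ^ 2) := by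
          gcongr with i _
          · exact hsq 2 (by norm_num)
          · exact hsq _ (by omega)
      _ ≤ K ^ 2 / 2 := by
          rw [← Finset.mul_sum]
          have := mul_le_mul_of_nonneg_left (sum_one_div_odd_sq_le K) (sq_nonneg (K : ℝ))
          push_cast at this ⊢
          linarith
  have htot : ((S.filter fun p => Nat.Coprime p.1 p.2).card : ℝ) +
      (S.filter (fun p => ¬ Nat.Coprime p.1 p.2)).card = K ^ 2 := by
    have := Finset.card_filter_add_card_filter_not (s := S) (fun p => Nat.Coprime p.1 p.2)
    have h2 : S.card = K ^ 2 := by simp [S, sq]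
    rw [h2] at this
    exact_mod_cast this
  linarith

/-! ### Distances and parameters -/

namespace Infrastructure

variable {X : Type u} [Finite X] (I : Infrastructure X)

theorem dist_nonneg (x : X) : 0 ≤ I.dist x := (AddCircle.equivIco I.R 0 (I.d x)).2.1

theorem dist_lt (x : X) : I.dist x < I.R := by
  exact (AddCircle.equivIco I.R 0 (I.d x)).2.2.trans_eq (zero_add I.R)

theorem coe_dist (x : X) : (I.dist x : AddCircle I.R) = I.d x := AddCircle.coe_equivIco

theorem dist_injective : Function.Injective I.dist := fun x y h =>
  I.d_injective (by rw [← I.coe_dist x, ← I.coe_dist y, h])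

theorem coe_circumference : (I.R : AddCircle I.R) = 0 := AddCircle.coe_period _

theorem babyDist_pos (x : X) : 0 < I.babyDist x := (I.babyDist_isLeast x).1.1

theorem giantDist_nonneg (x y : X) : 0 ≤ I.giantDist x y := (I.giantDist_isLeast x y).1.1

theorem babyDist_le_sub {x y : X} (h : I.dist x < I.dist y) :
    I.babyDist x ≤ I.dist y - I.dist x := by
  refine (I.babyDist_isLeast x).2 ⟨sub_pos.2 h, y, ?_⟩
  rw [AddCircle.coe_sub, I.coe_dist, I.coe_dist]; abel

theorem dist_add_babyDist_le (x : X) : I.dist x + I.babyDist x ≤ I.R := by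
  have : I.babyDist x ≤ I.R - I.dist x := by
    refine (I.babyDist_isLeast x).2 ⟨sub_pos.2 (I.dist_lt x), I.x₀, ?_⟩
    rw [AddCircle.coe_sub, I.coe_dist, I.coe_circumference, I.d_x₀]; abel
  linarith

theorem babyDist_le (x : X) : I.babyDist x ≤ I.R := by
  linarith [I.dist_add_babyDist_le x, I.dist_nonneg x]

theorem giantDist_le (x y : X) : I.giantDist x y ≤ I.R := by
  by_contra! h
  have hmem : I.giantDist x y - I.R ∈ I.giantSet x y := by
    refine ⟨by linarith, ?_⟩
    rw [AddCircle.coe_sub, I.coe_circumference, sub_zero]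
    exact (I.giantDist_isLeast x y).1.2
  linarith [(I.giantDist_isLeast x y).2 hmem, I.R_pos]

theorem dmin_le (x : X) : I.dmin ≤ I.babyDist x :=
  ciInf_le (Set.finite_range _).bddBelow x

theorem dmin_pos : 0 < I.dmin := by
  have : Nonempty X := ⟨I.x₀⟩
  obtain ⟨y, hy⟩ := Finite.exists_min I.babyDist
  exact (I.babyDist_pos y).trans_le (le_ciInf hy)

/-- The half-open arcs from the elements to their baby steps are disjoint, so their lengths add up
to at most the circumference. -/
theorem sum_babyDist_le [Fintype X] : ∑ x, I.babyDist x ≤ I.R := by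
  have hdisj : (↑(Finset.univ : Finset X) : Set X).PairwiseDisjoint
      fun x => Set.Ico (I.dist x) (I.dist x + I.babyDist x) := by
    intro x _ y _ hxy
    have key : ∀ x y, I.dist x < I.dist y →
        Disjoint (Set.Ico (I.dist x) (I.dist x + I.babyDist x))
          (Set.Ico (I.dist y) (I.dist y + I.babyDist y)) := by
      intro x y h
      rw [Set.disjoint_left]
      rintro t ⟨_, h2⟩ ⟨h3, _⟩
      linarith [I.babyDist_le_sub h]
    rcases lt_or_gt_of_ne (I.dist_injective.ne hxy) with h | h
    · exact key x y h
    · exact (key y x h).symm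
  have h := MeasureTheory.measure_biUnion_finset (μ := MeasureTheory.volume) hdisj
    (fun x _ => measurableSet_Ico)
  have hsub : (⋃ x ∈ (Finset.univ : Finset X),
      Set.Ico (I.dist x) (I.dist x + I.babyDist x)) ⊆ Set.Ico 0 I.R := by
    intro t ht
    simp only [Set.mem_iUnion] at ht
    obtain ⟨x, _, h1, h2⟩ := ht
    exact ⟨(I.dist_nonneg x).trans h1, h2.trans_le (I.dist_add_babyDist_le x)⟩
  have h2 := MeasureTheory.measure_mono (μ := MeasureTheory.volume) hsub
  rw [h] at h2
  simp only [Real.volume_Ico, add_sub_cancel_left, sub_zero] at h2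
  rw [← ENNReal.ofReal_sum_of_nonneg (fun x _ => (I.babyDist_pos x).le),
    ENNReal.ofReal_le_ofReal_iff I.R_pos.le] at h2
  exact h2

theorem card_mul_dmin_le : Nat.card X * I.dmin ≤ I.R := by
  have := Fintype.ofFinite X
  refine le_trans ?_ I.sum_babyDist_le
  rw [Nat.card_eq_fintype_card, ← nsmul_eq_mul, ← Finset.card_univ]
  exact Finset.card_nsmul_le_sum _ _ _ fun x _ => I.dmin_le x

theorem two_le_cmin_mul_dmin : 2 ≤ I.cmin * I.dmin := by
  have h : 2 / I.dmin ≤ I.cmin := Nat.le_ceil _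
  rwa [div_le_iff₀ I.dmin_pos] at h

theorem two_mul_card_le : 2 * (Nat.card X : ℝ) ≤ I.R * I.cmin := by
  have h1 := I.card_mul_dmin_le
  have h2 := I.two_le_cmin_mul_dmin
  have h3 : (0 : ℝ) ≤ Nat.card X := Nat.cast_nonneg _
  have h4 : (0 : ℝ) ≤ I.cmin := Nat.cast_nonneg _
  nlinarith

theorem six_le_circumference_mul_cmin (hX : 3 ≤ Nat.card X) : 6 ≤ I.R * I.cmin := by
  have : (3 : ℝ) ≤ Nat.card X := by exact_mod_cast hX
  linarith [I.two_mul_card_le]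

theorem cmin_pos : 0 < I.cmin := Nat.ceil_pos.2 (div_pos two_pos I.dmin_pos)

variable {I}

theorem GoodEstimate.two_le {M : ℕ} {Rhat : ℝ} (h : I.GoodEstimate M Rhat) : 2 ≤ M := by
  have h1 := h.hM
  have h2 := I.R_pos
  have : (1 : ℝ) < M := by linarith
  exact_mod_cast this

/-- The estimate `R̂` is much more precise than the smallest distance. -/
theorem GoodEstimate.abs_sub_le {M : ℕ} {Rhat : ℝ} (h : I.GoodEstimate M Rhat) :
    |I.R - Rhat| ≤ I.dmin / 128 := by
  refine h.hR.trans ?_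
  have hM : (2 : ℝ) ≤ M := by exact_mod_cast h.two_le
  have hc : (0 : ℝ) < I.cmin := by exact_mod_cast I.cmin_pos
  rw [div_le_div_iff₀ (by positivity) (by norm_num)]
  have h2 := I.two_le_cmin_mul_dmin
  have h3 := I.dmin_pos
  nlinarith [mul_le_mul (show (4 : ℝ) ≤ (M : ℝ) ^ 2 by nlinarith) h2 (by norm_num) (by positivity)]

/-- Dirichlet approximation supplies the multiplier. -/
theorem GoodEstimate.exists_goodMultiplier {M : ℕ} {Rhat : ℝ} (hX : 3 ≤ Nat.card X)
    (h : I.GoodEstimate M Rhat) : ∃ q, I.GoodMultiplier M q Rhat := by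
  have hM := h.two_le
  obtain ⟨q, hq0, hq, hr⟩ := Real.exists_nat_abs_mul_sub_round_le (Rhat * I.cmin)
    (show 0 < 4 * M by omega)
  refine ⟨q, hq0, hq, ?_⟩
  have hMR : (2 : ℝ) ≤ M := by exact_mod_cast hM
  have hc : (0 : ℝ) < I.cmin := by exact_mod_cast I.cmin_pos
  have hq4 : (q : ℝ) ≤ 4 * M := by exact_mod_cast hq
  have h1 := h.abs_sub_le
  have hRhat : 0 ≤ Rhat := by
    have h2 := I.card_mul_dmin_le
    have h3 : (3 : ℝ) ≤ Nat.card X := by exact_mod_cast hX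
    have := abs_le.1 h1
    nlinarith [I.dmin_pos]
  have hround : (round (Rhat * (I.paramN q)) : ℤ) = (I.paramB q Rhat : ℤ) := by
    unfold paramB
    rw [Int.toNat_of_nonneg]
    rw [round_eq]
    exact Int.floor_nonneg.2 (by positivity)
  have heq : (q : ℝ) * (Rhat * I.cmin) = Rhat * I.paramN q := by
    unfold paramN; push_cast; ring
  rw [heq, hround] at hr
  have hr' : |Rhat * I.paramN q - (I.paramB q Rhat : ℝ)| ≤ 1 / (4 * M) := by
    refine (by exact_mod_cast hr : _ ≤ 1 / ((4 * M : ℕ) + 1 : ℝ)).trans ?_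
    push_cast
    gcongr; linarith
  have h2 : |(I.R - Rhat) * I.paramN q| ≤ 1 / (4 * M) := by
    rw [abs_mul, Nat.abs_cast]
    calc _ ≤ 1 / (16 * (M : ℝ) ^ 2 * I.cmin) * (4 * M * I.cmin) := by
          have := h.hR
          unfold paramN
          push_cast
          gcongr
      _ = 1 / (4 * M) := by field_simp; norm_num
  have h3 : |(I.paramB q Rhat : ℝ) - I.R * I.paramN q| ≤ 1 / (2 * M) := by
    have e : 1 / (2 * (M : ℝ)) = 1 / (4 * M) + 1 / (4 * M) := by field_simp; norm_num
    rw [abs_le] at *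
    constructor <;> linarith
  calc |(M : ℝ) * I.paramB q Rhat - M * I.R * I.paramN q|
      = M * |(I.paramB q Rhat : ℝ) - I.R * I.paramN q| := by
        rw [← abs_of_nonneg (show (0 : ℝ) ≤ M by positivity), ← abs_mul, abs_of_nonneg
          (show (0 : ℝ) ≤ M by positivity)]; ring_nf
    _ ≤ M * (1 / (2 * M)) := by gcongr
    _ = 1 / 2 := by field_simp

theorem GoodMultiplier.abs_sub_le {M q : ℕ} {Rhat : ℝ} (h : I.GoodMultiplier M q Rhat)
    (hM : 2 ≤ M) : |(I.paramB q Rhat : ℝ) - I.R * I.paramN q| ≤ 1 / (2 * M) := by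
  have hMR : (2 : ℝ) ≤ M := by exact_mod_cast hM
  have h1 := h.near
  rw [mul_assoc, ← mul_sub, abs_mul, Nat.abs_cast] at h1
  rw [le_div_iff₀ (by positivity)]
  linarith

theorem GoodMultiplier.abs_sub_le_quarter {M q : ℕ} {Rhat : ℝ} (h : I.GoodMultiplier M q Rhat)
    (hM : 2 ≤ M) : |(I.paramB q Rhat : ℝ) - I.R * I.paramN q| ≤ 1 / 4 := by
  have hMR : (2 : ℝ) ≤ M := by exact_mod_cast hM
  refine (h.abs_sub_le hM).trans ?_
  rw [div_le_div_iff₀ (by positivity) (by norm_num)]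
  linarith

variable (I) in
theorem six_mul_le_circumference_mul_paramN (hX : 3 ≤ Nat.card X) (q : ℕ) :
    6 * (q : ℝ) ≤ I.R * I.paramN q := by
  have h := mul_le_mul_of_nonneg_left (I.six_le_circumference_mul_cmin hX)
    (Nat.cast_nonneg (α := ℝ) q)
  unfold paramN
  push_cast
  linarith

variable (I) in
theorem two_mul_mul_card_le (q : ℕ) :
    2 * (q : ℝ) * (Nat.card X : ℝ) ≤ I.R * I.paramN q := by
  have h := mul_le_mul_of_nonneg_left I.two_mul_card_le (Nat.cast_nonneg (α := ℝ) q)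
  unfold paramN
  push_cast
  linarith

theorem GoodMultiplier.six_mul_le_paramB {M q : ℕ} {Rhat : ℝ} (h : I.GoodMultiplier M q Rhat)
    (hX : 3 ≤ Nat.card X) (hM : 2 ≤ M) : 6 * q ≤ I.paramB q Rhat := by
  have h1 := abs_le.1 (h.abs_sub_le_quarter hM)
  have h2 := I.six_mul_le_circumference_mul_paramN hX q
  have : ((6 * q : ℕ) : ℝ) < (I.paramB q Rhat : ℝ) + 1 := by push_cast; linarith
  have : 6 * q < I.paramB q Rhat + 1 := by exact_mod_cast this
  omega

end Infrastructure

namespace Infrastructure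

variable {X : Type u} [Finite X] {I : Infrastructure X}

/-! ### Error propagation in the approximate arithmetic -/

variable (I) in
/-- The pair `p = (y, f)` represents the point `t` of the circle up to an error of at most `e`. -/
def ApproxRep (e : ℝ) (p : X × ℝ) (t : AddCircle I.R) : Prop :=
  ∃ δ : ℝ, |δ| ≤ e ∧ I.d p.1 + ((p.2 + δ : ℝ) : AddCircle I.R) = t

theorem ApproxRep.mono {e e' : ℝ} {p : X × ℝ} {t : AddCircle I.R} (h : I.ApproxRep e p t)
    (he : e ≤ e') : I.ApproxRep e' p t :=
  let ⟨δ, h1, h2⟩ := h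
  ⟨δ, h1.trans he, h2⟩

theorem approxRep_zero (x : X) : I.ApproxRep 0 (x, 0) (I.d x) := ⟨0, by simp, by simp⟩

variable (I) in
theorem bs_bsInv (x : X) : I.bs (I.bsInv x) = x :=
  (Equiv.ofBijective I.bs I.bs_bijective).apply_symm_apply x

variable (I) in
theorem d_iterate_bs (k : ℕ) (x : X) : I.d (I.bs^[k] x) =
    I.d x + ((∑ i ∈ Finset.range k, I.babyDist (I.bs^[i] x) : ℝ) : AddCircle I.R) := by
  induction k with
  | zero => simp
  | succ k ih =>
    rw [Function.iterate_succ_apply', I.d_bs, ih, Finset.sum_range_succ, AddCircle.coe_add,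
      add_assoc]

namespace ApproxDist

variable {m : ℕ} (D : I.ApproxDist m)

theorem approxRep_reduceStep {e : ℝ} {p : X × ℝ} {t : AddCircle I.R} (h : I.ApproxRep e p t) :
    I.ApproxRep (e + 1 / 2 ^ m) (D.reduceStep p) t := by
  obtain ⟨δ, h1, h2⟩ := h
  unfold reduceStep
  split_ifs with hneg hbig
  · refine ⟨δ + (I.babyDist (I.bsInv p.1) - D.baby (I.bsInv p.1)),
      (abs_add_le _ _).trans (add_le_add h1 (D.baby_lt _).le), ?_⟩
    rw [← h2]
    conv_rhs => rw [← I.bs_bsInv p.1, I.d_bs]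
    rw [add_assoc (I.d _), ← AddCircle.coe_add]
    congr 2
    ring
  · refine ⟨δ - (I.babyDist p.1 - D.baby p.1),
      (abs_sub _ _).trans (add_le_add h1 (D.baby_lt _).le), ?_⟩
    rw [← h2, I.d_bs, add_assoc, ← AddCircle.coe_add]
    congr 2
    ring
  · exact ⟨δ, h1.trans (by linarith [show (0 : ℝ) < 1 / 2 ^ m by positivity]), h2⟩

theorem approxRep_iterate_reduceStep {e : ℝ} {p : X × ℝ} {t : AddCircle I.R}
    (h : I.ApproxRep e p t) (n : ℕ) :
    I.ApproxRep (e + n * (1 / 2 ^ m)) (D.reduceStep^[n] p) t := by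
  induction n with
  | zero => simpa using h
  | succ n ih =>
    rw [Function.iterate_succ_apply']
    exact (D.approxRep_reduceStep ih).mono (by push_cast; linarith)

theorem isReduced_zero {μ : ℝ} (hμ : 0 < μ) (hD : ∀ y, μ ≤ D.baby y) (x : X) :
    D.IsReduced (x, 0) := ⟨le_rfl, hμ.trans_le (hD x)⟩

/-- Each reduction step brings the second component closer to `0` by at least `μ`. -/
theorem exists_isReduced_iterate {μ : ℝ} (hμ : 0 < μ) (hD : ∀ y, μ ≤ D.baby y) (n : ℕ) :
    ∀ p : X × ℝ, |p.2| ≤ n * μ → ∃ j ≤ n + 1, D.IsReduced (D.reduceStep^[j] p) := by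
  induction n with
  | zero =>
    intro p hp
    have h0 : p.2 = 0 := by simpa using hp
    exact ⟨0, Nat.zero_le _, by simp [h0], by simpa [h0] using hμ.trans_le (hD p.1)⟩
  | succ n ih =>
    intro p hp
    push_cast at hp
    obtain ⟨hp1, hp2⟩ := abs_le.1 hp
    by_cases hneg : p.2 < 0
    · have hstep : D.reduceStep p = (I.bsInv p.1, p.2 + D.baby (I.bsInv p.1)) := by
        simp [reduceStep, hneg]
      have hb := hD (I.bsInv p.1)
      by_cases h0 : 0 ≤ p.2 + D.baby (I.bsInv p.1)
      · refine ⟨1, by omega, ?_⟩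
        rw [Function.iterate_one, hstep]
        exact ⟨h0, by simpa using hneg⟩
      · obtain ⟨j, hj, hr⟩ := ih (D.reduceStep p) (by
          rw [hstep, abs_of_neg (not_le.1 h0)]; linarith)
        exact ⟨j + 1, by omega, by rwa [Function.iterate_succ_apply]⟩
    · by_cases hbig : D.baby p.1 ≤ p.2
      · have hstep : D.reduceStep p = (I.bs p.1, p.2 - D.baby p.1) := by
          simp [reduceStep, hneg, hbig]
        have hb := hD p.1
        obtain ⟨j, hj, hr⟩ := ih (D.reduceStep p) (by
          rw [hstep, abs_of_nonneg (sub_nonneg.2 hbig)]; linarith)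
        exact ⟨j + 1, by omega, by rwa [Function.iterate_succ_apply]⟩
      · exact ⟨0, Nat.zero_le _, not_lt.1 hneg, not_le.1 hbig⟩

theorem reduce_spec {μ : ℝ} (hμ : 0 < μ) (hD : ∀ y, μ ≤ D.baby y) {n : ℕ} {e : ℝ}
    {p : X × ℝ} {t : AddCircle I.R} (hp : |p.2| ≤ n * μ) (h : I.ApproxRep e p t) :
    D.IsReduced (D.reduce p) ∧ I.ApproxRep (e + (n + 1) * (1 / 2 ^ m)) (D.reduce p) t := by
  classical
  obtain ⟨j, hj, hr⟩ := D.exists_isReduced_iterate hμ hD n p hp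
  have hex : ∃ n : ℕ, D.IsReduced (D.reduceStep^[n] p) := ⟨j, hr⟩
  rw [reduce, dif_pos hex]
  refine ⟨Nat.find_spec hex, (D.approxRep_iterate_reduceStep h _).mono ?_⟩
  have : (Nat.find hex : ℝ) ≤ n + 1 := by exact_mod_cast (Nat.find_min' hex hr).trans hj
  gcongr

theorem baby_le (y : X) : D.baby y ≤ I.R + 1 := by
  have h1 := (abs_lt.1 (D.baby_lt y)).1
  have h2 := I.babyDist_le y
  have : (1 : ℝ) / 2 ^ m ≤ 1 := by
    rw [div_le_one (by positivity)]; exact one_le_pow₀ (by norm_num)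
  linarith

theorem add_spec {μ : ℝ} (hμ : 0 < μ) (hD : ∀ y, μ ≤ D.baby y) {n : ℕ}
    (hn : 2 * I.R + 3 ≤ n * μ) {e e' : ℝ} {p p' : X × ℝ} {t t' : AddCircle I.R}
    (hp : D.IsReduced p) (hp' : D.IsReduced p') (h : I.ApproxRep e p t)
    (h' : I.ApproxRep e' p' t') :
    D.IsReduced (D.add p p') ∧
      I.ApproxRep (e + e' + (n + 2) * (1 / 2 ^ m)) (D.add p p') (t + t') := by
  obtain ⟨δ, h1, h2⟩ := h
  obtain ⟨δ', h1', h2'⟩ := h'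
  have hone : (1 : ℝ) / 2 ^ m ≤ 1 := by
    rw [div_le_one (by positivity)]; exact one_le_pow₀ (by norm_num)
  have hg := D.giant_lt p.1 p'.1
  have key := D.reduce_spec hμ hD (n := n) (e := e + e' + 1 / 2 ^ m)
    (p := (I.gs p.1 p'.1, p.2 + p'.2 - D.giant p.1 p'.1)) (t := t + t') ?_ ?_
  · exact ⟨key.1, key.2.mono (by linarith)⟩
  · have hg' := abs_lt.1 hg
    have hb := D.baby_le p.1
    have hb' := D.baby_le p'.1
    have hg1 := I.giantDist_nonneg p.1 p'.1
    have hg2 := I.giantDist_le p.1 p'.1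
    have hR := I.R_pos
    refine le_trans ?_ hn
    rw [abs_le]
    constructor <;> simp only <;> linarith [hp.1, hp.2, hp'.1, hp'.2]
  · refine ⟨δ + δ' - (I.giantDist p.1 p'.1 - D.giant p.1 p'.1), ?_, ?_⟩
    · refine (abs_sub _ _).trans (add_le_add ((abs_add_le _ _).trans (add_le_add h1 h1')) hg.le)
    · rw [← h2, ← h2', I.d_gs]
      have : (p.2 + p'.2 - D.giant p.1 p'.1 +
          (δ + δ' - (I.giantDist p.1 p'.1 - D.giant p.1 p'.1)) : ℝ) =
          (p.2 + δ) + (p'.2 + δ') - I.giantDist p.1 p'.1 := by ring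
      simp only
      rw [this, AddCircle.coe_sub, AddCircle.coe_add]
      abel

/-- Doubling and adding: the error of `a · p` grows linearly in `a`. -/
theorem nsmul_spec {μ : ℝ} (hμ : 0 < μ) (hD : ∀ y, μ ≤ D.baby y) {n : ℕ}
    (hn : 2 * I.R + 3 ≤ n * μ) (a : ℕ) : ∀ {e : ℝ} {p : X × ℝ} {t : AddCircle I.R},
    D.IsReduced p → I.ApproxRep e p t →
    D.IsReduced (D.nsmul a p) ∧
      I.ApproxRep (a * (e + 2 * ((n + 2) * (1 / 2 ^ m)))) (D.nsmul a p) (a • t) := by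
  induction a using Nat.strong_induction_on with
  | _ a ih =>
    intro e p t hp h
    set σ : ℝ := (n + 2) * (1 / 2 ^ m) with hσ
    have hσ0 : 0 ≤ σ := by positivity
    rw [nsmul]
    split_ifs with h0 h1
    · subst h0
      refine ⟨D.isReduced_zero hμ hD _, ?_⟩
      have := approxRep_zero (I := I) I.x₀
      rw [I.d_x₀] at this
      simpa using this
    · obtain ⟨h2, h3⟩ := D.add_spec hμ hD hn hp hp h h
      obtain ⟨h4, h5⟩ := ih (a / 2) (by omega) h2 h3
      obtain ⟨h6, h7⟩ := D.add_spec hμ hD hn hp h4 h h5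
      refine ⟨h6, ?_⟩
      have ha : a = 2 * (a / 2) + 1 := by omega
      have hac : (a : ℝ) = 2 * (a / 2 : ℕ) + 1 := by exact_mod_cast ha
      have ht : t + (a / 2) • (t + t) = a • t := by
        conv_rhs => rw [ha]
        rw [← two_nsmul, ← mul_nsmul', add_nsmul, one_nsmul, mul_comm, add_comm]
      rw [ht] at h7
      refine h7.mono ?_
      rw [← hσ, hac]
      have : (0 : ℝ) ≤ (a / 2 : ℕ) := Nat.cast_nonneg _
      nlinarith
    · obtain ⟨h2, h3⟩ := D.add_spec hμ hD hn hp hp h h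
      obtain ⟨h4, h5⟩ := ih (a / 2) (by omega) h2 h3
      refine ⟨h4, ?_⟩
      have ha : a = 2 * (a / 2) := by omega
      have hac : (a : ℝ) = 2 * (a / 2 : ℕ) := by exact_mod_cast ha
      have ht : (a / 2) • (t + t) = a • t := by
        conv_rhs => rw [ha]
        rw [← two_nsmul, ← mul_nsmul', mul_comm]
      rw [ht] at h5
      refine h5.mono ?_
      rw [← hσ, hac]
      have : (0 : ℝ) ≤ (a / 2 : ℕ) := Nat.cast_nonneg _
      nlinarith

/-- The computed distance of `bsᵏ(x₀)` is accurate; replacing it by the lower bound `dk` does no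
harm, because the true distance respects that bound. -/
theorem abs_farDist_sub_le {k : ℕ} {dk : ℝ} (hk : I.SpansAtLeast k dk) :
    |D.farDist k dk - ∑ i ∈ Finset.range k, I.babyDist (I.bs^[i] I.x₀)| ≤ k * (1 / 2 ^ m) := by
  have h1 : |∑ i ∈ Finset.range k, D.baby (I.bs^[i] I.x₀) -
      ∑ i ∈ Finset.range k, I.babyDist (I.bs^[i] I.x₀)| ≤ k * (1 / 2 ^ m) := by
    rw [← Finset.sum_sub_distrib]
    refine (Finset.abs_sum_le_sum_abs _ _).trans ?_
    refine (Finset.sum_le_card_nsmul _ _ (1 / 2 ^ m) fun i _ => ?_).trans_eq (by simp)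
    rw [abs_sub_comm]
    exact (D.baby_lt _).le
  have h2 := hk.2.2 I.x₀
  unfold farDist
  have hη : (0 : ℝ) ≤ k * (1 / 2 ^ m) := by positivity
  rcases max_cases dk (∑ i ∈ Finset.range k, D.baby (I.bs^[i] I.x₀)) with ⟨h, h'⟩ | ⟨h, _⟩
  · rw [h]
    rw [abs_le] at h1 ⊢
    constructor <;> linarith
  · rw [h]; exact h1

theorem hApprox_spec {μ : ℝ} (hμ : 0 < μ) (hD : ∀ y, μ ≤ D.baby y) {n n' : ℕ}
    (hn : 2 * I.R + 3 ≤ n * μ) {k T : ℕ} {dk : ℝ} (hk : I.SpansAtLeast k dk)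
    (hn' : (k + 1) * (I.R + 1) ≤ n' * μ) {r : ℝ} (hr : 0 ≤ r) (hrT : r ≤ T * dk) :
    D.IsReduced (D.hApprox k dk r) ∧
      I.ApproxRep (T * (2 * ((n + 2) * (1 / 2 ^ m))) + T * (k * (1 / 2 ^ m)) +
        (n' + 1) * (1 / 2 ^ m)) (D.hApprox k dk r) (r : AddCircle I.R) := by
  have hdk := hk.2.1
  set F := D.farDist k dk with hF
  have hFdk : dk ≤ F := le_max_left _ _
  have hF0 : 0 < F := hdk.trans_le hFdk
  have hFs := D.abs_farDist_sub_le hk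
  rw [← hF] at hFs
  set s := ∑ i ∈ Finset.range k, I.babyDist (I.bs^[i] I.x₀) with hs
  have hsR : s ≤ k * I.R :=
    (Finset.sum_le_card_nsmul _ _ I.R fun i _ => I.babyDist_le _).trans_eq (by simp)
  have hone : (1 : ℝ) / 2 ^ m ≤ 1 := by
    rw [div_le_one (by positivity)]; exact one_le_pow₀ (by norm_num)
  have hround : (0 : ℤ) ≤ round (r / F) := by
    rw [round_eq]; exact Int.floor_nonneg.2 (by positivity)
  set a : ℕ := (round (r / F)).toNat with ha
  have haz : ((a : ℤ) : ℝ) = (round (r / F) : ℤ) := by rw [ha, Int.toNat_of_nonneg hround]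
  have har : |r - a * F| ≤ F / 2 := by
    have h := abs_sub_round (r / F)
    rw [← haz] at h
    have h2 : r - a * F = (r / F - a) * F := by field_simp
    rw [h2, abs_mul, abs_of_pos hF0]
    push_cast at h
    nlinarith
  have haT : (a : ℝ) ≤ T := by
    have h1 : r / F ≤ T := by
      rw [div_le_iff₀ hF0]
      exact hrT.trans (by gcongr)
    have h2 : (round (r / F) : ℤ) ≤ T := by
      rw [round_eq]
      refine Int.lt_add_one_iff.1 (Int.floor_lt.2 ?_)
      push_cast
      linarith
    have h3 : (a : ℤ) ≤ T := by rw [ha, Int.toNat_of_nonneg hround]; exact h2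
    exact_mod_cast h3
  obtain ⟨h1, δ, h2, h3⟩ := D.nsmul_spec hμ hD hn a
    (D.isReduced_zero hμ hD (I.bs^[k] I.x₀)) (approxRep_zero _)
  rw [zero_add] at h2
  set p := D.nsmul a (I.bs^[k] I.x₀, 0) with hp
  have heq : D.hApprox k dk r = D.reduce (p.1, p.2 + (r - a * F)) := rfl
  have hd : I.d (I.bs^[k] I.x₀) = (s : AddCircle I.R) := by
    rw [I.d_iterate_bs, I.d_x₀, zero_add]
  rw [hd, ← AddCircle.coe_nsmul, nsmul_eq_mul] at h3
  rw [heq]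
  have hσ : (0 : ℝ) ≤ (n + 2) * (1 / 2 ^ m) := by positivity
  refine D.reduce_spec hμ hD (n := n') (e := T * (2 * ((n + 2) * (1 / 2 ^ m))) +
    T * (k * (1 / 2 ^ m))) ?_ ⟨δ + a * (F - s), ?_, ?_⟩
  · refine le_trans ?_ hn'
    have hb := D.baby_le p.1
    have hFle : F ≤ k * (I.R + 1) := by
      have := (abs_le.1 hFs).2
      have : (k : ℝ) * (1 / 2 ^ m) ≤ k * 1 := by gcongr
      linarith
    have hR := I.R_pos
    have hk0 : (0 : ℝ) ≤ k * (I.R + 1) := by positivity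
    refine (abs_add_le _ _).trans ?_
    rw [abs_of_nonneg h1.1]
    linarith [h1.2]
  · refine (abs_add_le _ _).trans (add_le_add (h2.trans (by gcongr)) ?_)
    rw [abs_mul, Nat.abs_cast]
    gcongr
  · simp only
    have : (p.2 + (r - a * F) + (δ + a * (F - s)) : ℝ) = (p.2 + δ) + (r - a * s) := by ring
    rw [this, AddCircle.coe_add, ← add_assoc, h3, ← AddCircle.coe_add]
    congr 1
    ring

theorem gApprox_spec {μ : ℝ} (hμ : 0 < μ) (hD : ∀ y, μ ≤ D.baby y) {n n' : ℕ}
    (hn : 2 * I.R + 3 ≤ n * μ) {k T : ℕ} {dk : ℝ} (hk : I.SpansAtLeast k dk)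
    (hn' : (k + 1) * (I.R + 1) ≤ n' * μ) {r : ℝ} (hr : 0 ≤ r) (hrT : r ≤ T * dk) (x : X)
    (a : ℕ) :
    D.IsReduced (D.gApprox k dk x a r) ∧
      I.ApproxRep (a * (2 * ((n + 2) * (1 / 2 ^ m))) +
        (T * (2 * ((n + 2) * (1 / 2 ^ m))) + T * (k * (1 / 2 ^ m)) + (n' + 1) * (1 / 2 ^ m)) +
        (n + 2) * (1 / 2 ^ m))
        (D.gApprox k dk x a r) (a • I.d x + (r : AddCircle I.R)) := by
  obtain ⟨h1, h2⟩ := D.nsmul_spec hμ hD hn a (D.isReduced_zero hμ hD x) (approxRep_zero _)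
  obtain ⟨h3, h4⟩ := D.hApprox_spec hμ hD hn hk hn' hr hrT
  rw [zero_add] at h2
  exact D.add_spec hμ hD hn h1 h3 h2 h4

/-- If `t` keeps a distance from all cell boundaries `d(y) + i/N` that exceeds the accumulated
error, then the approximate representation of `t` has the same quantization as the exact one. -/
theorem exists_isFRep_of_far_from_boundary {E ε : ℝ} {N : ℕ} (hN : 0 < N)
    (hε : E + 1 / 2 ^ m < ε)
    {p : X × ℝ} {t : AddCircle I.R} (hp : D.IsReduced p) (h : I.ApproxRep E p t)
    (hfar : ∀ (y : X) (i : ℕ) (e : ℝ), (i : ℝ) / N ≤ I.babyDist y → |e| < ε →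
      t ≠ I.d y + ((i / N + e : ℝ) : AddCircle I.R)) :
    ∃ p' : X × ℝ, I.IsFRep p' t ∧ (p.1, ⌊p.2 * N⌋) = (p'.1, ⌊p'.2 * N⌋) := by
  obtain ⟨δ, hδ, ht⟩ := h
  have hη : (0 : ℝ) < 1 / 2 ^ m := by positivity
  have hNR : (0 : ℝ) < N := by exact_mod_cast hN
  have hbaby := abs_lt.1 (D.baby_lt p.1)
  have hδ' := abs_le.1 hδ
  have hp1 := hp.1
  have hp2 := hp.2
  set g := p.2 + δ with hg
  have hbs : ∀ e : ℝ, |e| < ε → g ≠ I.babyDist p.1 + e := by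
    intro e he hge
    refine hfar (I.bs p.1) 0 e (by simpa using (I.babyDist_pos _).le) he ?_
    rw [← ht, hge, I.d_bs, AddCircle.coe_add]
    simp [add_assoc]
  have h0 : 0 ≤ g := by
    by_contra! hneg
    refine hfar p.1 0 g (by simpa using (I.babyDist_pos _).le) ?_ (by rw [← ht]; simp)
    rw [abs_of_neg hneg]; linarith
  have h1 : g < I.babyDist p.1 := by
    by_contra! hge
    refine hbs (g - I.babyDist p.1) ?_ (by ring)
    rw [abs_of_nonneg (by linarith)]; linarith
  refine ⟨(p.1, g), ⟨h0, h1, ht⟩, ?_⟩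
  simp only [Prod.mk.injEq, true_and]
  have key : ∀ i : ℕ, ¬ (min p.2 g < i / N ∧ (i : ℝ) / N ≤ max p.2 g) := by
    rintro i ⟨hi1, hi2⟩
    by_cases hi : (i : ℝ) / N ≤ I.babyDist p.1
    · refine hfar p.1 i (g - i / N) hi ?_ (by rw [← ht]; congr 2; ring)
      rw [abs_lt]
      rcases le_total p.2 g with hle | hle
      · rw [min_eq_left hle] at hi1; rw [max_eq_right hle] at hi2
        constructor <;> linarith
      · rw [min_eq_right hle] at hi1; rw [max_eq_left hle] at hi2
        constructor <;> linarith
    · push Not at hi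
      refine hbs (g - I.babyDist p.1) ?_ (by ring)
      rcases le_total p.2 g with hle | hle
      · rw [max_eq_right hle] at hi2; linarith
      · rw [max_eq_left hle] at hi2
        rw [abs_of_neg (by linarith)]
        linarith
  have hlt : ∀ u v : ℝ, 0 ≤ u → 0 ≤ v → ⌊u * N⌋ < ⌊v * N⌋ →
      ∃ i : ℕ, u < i / N ∧ (i : ℝ) / N ≤ v := by
    intro u v _ hv hlt
    refine ⟨⌊v * N⌋.toNat, ?_, ?_⟩
    · rw [lt_div_iff₀ hNR]
      have h2 : ((⌊v * N⌋.toNat : ℤ) : ℝ) = ⌊v * N⌋ := by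
        rw [Int.toNat_of_nonneg (Int.floor_nonneg.2 (by positivity))]
      push_cast at h2
      rw [h2]
      exact Int.floor_lt.1 hlt
    · rw [div_le_iff₀ hNR]
      have h2 : ((⌊v * N⌋.toNat : ℤ) : ℝ) = ⌊v * N⌋ := by
        rw [Int.toNat_of_nonneg (Int.floor_nonneg.2 (by positivity))]
      push_cast at h2
      rw [h2]
      exact Int.floor_le _
  rcases lt_trichotomy ⌊p.2 * N⌋ ⌊g * N⌋ with hh | hh | hh
  · obtain ⟨i, hi1, hi2⟩ := hlt _ _ hp.1 h0 hh
    exact absurd ⟨(min_le_left _ _).trans_lt hi1, hi2.trans (le_max_right _ _)⟩ (key i)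
  · exact hh
  · obtain ⟨i, hi1, hi2⟩ := hlt _ _ h0 hp.1 hh
    exact absurd ⟨(min_le_right _ _).trans_lt hi1, hi2.trans (le_max_left _ _)⟩ (key i)

end ApproxDist

end Infrastructure

namespace Infrastructure

variable {X : Type u} [Finite X] {I : Infrastructure X}

/-! ### The random offset avoids the cell boundaries -/

/-- At most one grid point lies close to a point of a lattice whose period is the grid length. -/
theorem card_filter_near_lattice_le_one (J : ℕ) (θ : ℝ) [DecidablePred fun j : ℕ =>
    ∃ i : ℤ, |(j : ℝ) - θ - i * J| < 1 / 2] :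
    ((Finset.range J).filter fun j : ℕ => ∃ i : ℤ, |(j : ℝ) - θ - i * J| < 1 / 2).card ≤ 1 := by
  rw [Finset.card_le_one]
  intro j hj j' hj'
  simp only [Finset.mem_filter, Finset.mem_range] at hj hj'
  obtain ⟨hjJ, i, hi⟩ := hj
  obtain ⟨hjJ', i', hi'⟩ := hj'
  have h1 : |((j - j' - (i - i') * J : ℤ) : ℝ)| < 1 := by
    push_cast
    rw [abs_lt] at *
    constructor <;> linarith
  have h2 : (j - j' - (i - i') * J : ℤ) = 0 := by
    rw [← Int.abs_lt_one_iff]; exact_mod_cast h1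
  have h3 : i - i' = 0 := by
    by_contra hne
    have hJ : (0 : ℤ) < J := by omega
    rcases lt_or_gt_of_ne hne with h | h
    · have : (i - i') * J ≤ -1 * J := mul_le_mul_of_nonneg_right (by omega) hJ.le
      omega
    · have : 1 * (J : ℤ) ≤ (i - i') * J := mul_le_mul_of_nonneg_right (by omega) hJ.le
      omega
  rw [h3] at h2
  omega

/-- An equation between points of the circle, lifted to the real line. -/
theorem exists_int_mul_eq_of_add_coe_eq {R : ℝ} {u v : AddCircle R} {c r s : ℝ}
    (hc : (c : AddCircle R) = u - v) (h : v + (r : AddCircle R) = u + (s : AddCircle R)) :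
    ∃ l : ℤ, (l : ℝ) * R = r - (c + s) := by
  have hzero : ((r - (c + s) : ℝ) : AddCircle R) = 0 := by
    rw [AddCircle.coe_sub, AddCircle.coe_add, hc, eq_sub_of_add_eq' h]
    abel
  obtain ⟨l, hl⟩ := (AddCircle.coe_eq_zero_iff _).1 hzero
  exact ⟨l, by rw [← hl, zsmul_eq_mul]⟩

theorem babyDist_add_dmin_le (hX : 3 ≤ Nat.card X) (y : X) : I.babyDist y + I.dmin ≤ I.R := by
  classical
  have := Fintype.ofFinite X
  have : Nontrivial X := by
    rw [← Fintype.one_lt_card_iff_nontrivial, ← Nat.card_eq_fintype_card]; omega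
  obtain ⟨z, hz⟩ := exists_ne y
  refine le_trans ?_ I.sum_babyDist_le
  calc I.babyDist y + I.dmin ≤ I.babyDist y + I.babyDist z := by
        gcongr; exact I.dmin_le z
    _ = ∑ w ∈ {y, z}, I.babyDist w := (Finset.sum_pair hz.symm).symm
    _ ≤ _ := Finset.sum_le_sum_of_subset_of_nonneg (Finset.subset_univ _)
        fun w _ _ => (I.babyDist_pos w).le

theorem GoodEstimate.three_mul_dmin_sub_le {M : ℕ} {Rhat : ℝ} (h : I.GoodEstimate M Rhat)
    (hX : 3 ≤ Nat.card X) : 3 * I.dmin - I.dmin / 128 ≤ Rhat := by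
  have h1 := abs_le.1 h.abs_sub_le
  have h2 := I.card_mul_dmin_le
  have h3 : (3 : ℝ) ≤ Nat.card X := by exact_mod_cast hX
  have h4 := I.dmin_pos
  nlinarith

/-- The number of elements is at most `k ⌈R̂/dk⌉`. -/
theorem GoodEstimate.card_le {M : ℕ} {Rhat : ℝ} (h : I.GoodEstimate M Rhat)
    (hX : 3 ≤ Nat.card X) {k : ℕ} {dk : ℝ} (hk : I.SpansAtLeast k dk) :
    Nat.card X ≤ k * ⌈Rhat / dk⌉₊ := by
  have := Fintype.ofFinite X
  obtain ⟨hk0, hdk, hs⟩ := hk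
  set T := ⌈Rhat / dk⌉₊ with hT
  have hTd : Rhat ≤ T * dk := by
    rw [← div_le_iff₀ hdk]; exact Nat.le_ceil _
  have hRpos := h.three_mul_dmin_sub_le hX
  have hdm := I.dmin_pos
  have habs := abs_le.1 h.abs_sub_le
  have hkR : (1 : ℝ) ≤ k := by exact_mod_cast hk0
  -- summing the spans over all starting points counts every baby step `k` times
  have h1 : (Nat.card X : ℝ) * dk ≤ k * I.R := by
    calc (Nat.card X : ℝ) * dk = ∑ x : X, dk := by
          simp [Nat.card_eq_fintype_card]
      _ ≤ ∑ x : X, ∑ i ∈ Finset.range k, I.babyDist (I.bs^[i] x) :=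
          Finset.sum_le_sum fun x _ => hs x
      _ = ∑ i ∈ Finset.range k, ∑ x : X, I.babyDist (I.bs^[i] x) := Finset.sum_comm
      _ = ∑ i ∈ Finset.range k, ∑ x : X, I.babyDist x := by
          refine Finset.sum_congr rfl fun i _ => ?_
          exact Function.Bijective.sum_comp (I.bs_bijective.iterate i) I.babyDist
      _ ≤ k * I.R := by
          rw [Finset.sum_const, Finset.card_range, nsmul_eq_mul]
          gcongr
          exact I.sum_babyDist_le
  by_contra! hlt
  have h2 : (k : ℝ) * T + 1 ≤ Nat.card X := by exact_mod_cast hlt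
  have h3 := I.card_mul_dmin_le
  have h4 : dk ≤ k * (I.dmin / 128) := by
    have h5 : (k * T + 1) * dk ≤ k * I.R := (mul_le_mul_of_nonneg_right h2 hdk.le).trans h1
    have h6 : (k : ℝ) * Rhat ≤ k * (T * dk) := by gcongr
    have h7 : (k : ℝ) * (I.R - Rhat) ≤ k * (I.dmin / 128) := by gcongr; linarith
    nlinarith
  have hT0 : (0 : ℝ) ≤ T := Nat.cast_nonneg _
  have h5 : Rhat * 128 ≤ T * k * I.dmin := by
    have := mul_le_mul_of_nonneg_left h4 hT0
    linarith
  have h6 : (k * T + 1) * I.dmin ≤ I.R := (mul_le_mul_of_nonneg_right h2 hdm.le).trans h3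
  nlinarith

namespace ApproxDist

variable {m : ℕ} (D : I.ApproxDist m)

/-- The error bound of the approximate homomorphism, for a precision that is polynomially large
in `L`. -/
theorem error_lt {L : ℕ} (hL : 24 ≤ L) (hm : L ^ 5 ≤ 2 ^ m) {a T k n n' : ℕ} (ha : a ≤ L)
    (hT : T ≤ L) (hk : k ≤ L) (hn : n ≤ L) (hn' : n' ≤ L) :
    (a * (2 * ((n + 2) * (1 / 2 ^ m))) +
        (T * (2 * ((n + 2) * (1 / 2 ^ m))) + T * (k * (1 / 2 ^ m)) + (n' + 1) * (1 / 2 ^ m)) +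
        (n + 2) * (1 / 2 ^ m)) + 1 / 2 ^ m < (1 / (2 * L) : ℝ) := by
  have hLR : (24 : ℝ) ≤ L := by exact_mod_cast hL
  have hmR : (L : ℝ) ^ 5 ≤ 2 ^ m := by exact_mod_cast hm
  have haR : (a : ℝ) ≤ L := by exact_mod_cast ha
  have hTR : (T : ℝ) ≤ L := by exact_mod_cast hT
  have hkR : (k : ℝ) ≤ L := by exact_mod_cast hk
  have hnR : (n : ℝ) ≤ L := by exact_mod_cast hn
  have hn'R : (n' : ℝ) ≤ L := by exact_mod_cast hn'
  have hη : (0 : ℝ) < 1 / 2 ^ m := by positivity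
  have h1 : (1 : ℝ) / 2 ^ m ≤ 1 / (L : ℝ) ^ 5 := by gcongr
  set η : ℝ := 1 / 2 ^ m
  have hn2 : (n : ℝ) + 2 ≤ 2 * L := by linarith
  calc _ ≤ (L * (2 * (2 * L * η)) + (L * (2 * (2 * L * η)) + L * (L * η) + (L + 1) * η) +
        2 * L * η) + η := by gcongr
    _ = (9 * L ^ 2 + 3 * L + 2) * η := by ring
    _ ≤ 14 * L ^ 2 * η := by gcongr; nlinarith
    _ ≤ 14 * L ^ 2 * (1 / (L : ℝ) ^ 5) := by gcongr
    _ < 1 / (2 * L) := by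
        rw [mul_one_div, div_lt_div_iff₀ (by positivity) (by positivity)]
        have : (0 : ℝ) < (L : ℝ) ^ 3 := by positivity
        nlinarith [mul_pos this this, mul_le_mul hLR hLR (by norm_num) (by linarith)]

set_option maxHeartbeats 800000 in
/-- An offset for which the evaluation fails is close, modulo `1/N`, to one of the at most
`2 A |X|` numbers `d(y) - a d(x)` and `d(y) - a d(x) - R`. -/
theorem exists_near_of_not_evaluatesCorrectly (hX : 3 ≤ Nat.card X) {M q : ℕ} {Rhat : ℝ}
    (hE : I.GoodEstimate M Rhat) (hQ : I.GoodMultiplier M q Rhat) {k : ℕ} {dk : ℝ}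
    (hk : I.SpansAtLeast k dk) {J : ℕ}
    (hJ : 2 * I.paramA M q Rhat * k * ⌈Rhat / dk⌉₊ ≤ J)
    (hm : (J * I.paramN q) ^ 5 ≤ 2 ^ m) (x : X) {j : ℕ} (hj : j < J)
    (hnot : ¬ I.EvaluatesCorrectly x (I.paramA M q Rhat) (I.paramB q Rhat) (I.paramN q)
      (J * I.paramN q) j (D.gN k dk x (I.paramN q) (J * I.paramN q) j)) :
    ∃ a < I.paramA M q Rhat, ∃ y : X, ∃ w < 2, ∃ i : ℤ,
      |(j : ℝ) - (J * I.paramN q : ℕ) * ((AddCircle.equivIco I.R 0 (I.d y - a • I.d x) : ℝ)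
        - (w : ℕ) * I.R) - i * J| < 1 / 2 := by
  obtain ⟨hk0, hdk, -⟩ := id hk
  have hM2 := hE.two_le
  have hB6 := hQ.six_mul_le_paramB hX hM2
  have hBR := abs_le.1 (hQ.abs_sub_le_quarter hM2)
  have hRpos := hE.three_mul_dmin_sub_le hX
  have hdm := I.dmin_pos
  have hcd := I.two_le_cmin_mul_dmin
  have hq := hQ.pos
  have hMR := hE.hM
  have hT0 : 0 < ⌈Rhat / dk⌉₊ := Nat.ceil_pos.2 (div_pos (by linarith) hdk)
  set T := ⌈Rhat / dk⌉₊ with hT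
  set B := I.paramB q Rhat with hB
  set A := I.paramA M q Rhat with hA
  set N := I.paramN q with hN
  set L := J * N with hL
  have hAM : A = M * B := rfl
  have hcN : I.cmin ≤ N := Nat.le_mul_of_pos_left _ hq
  have hc := I.cmin_pos
  have hN0 : 0 < N := by omega
  have hA0 : M * 6 ≤ A := by rw [hAM]; exact Nat.mul_le_mul_left _ (by omega)
  have hAp : 0 < A := by omega
  have hAL : 2 * A * k * T * N ≤ L := Nat.mul_le_mul_right _ hJ
  have hkT : 1 ≤ k * T := Nat.mul_pos hk0 hT0
  have hkTN : 1 ≤ k * T * N := Nat.mul_pos hkT hN0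
  have hassoc : 2 * A * k * T * N = 2 * A * (k * T * N) := by ring
  have h2A : 2 * A ≤ L := by
    rw [hassoc] at hAL
    exact (Nat.le_mul_of_pos_right _ hkTN).trans hAL
  have hkL : k ≤ L := by
    calc k ≤ k * (2 * A * T * N) := Nat.le_mul_of_pos_right _ (by positivity)
      _ = 2 * A * k * T * N := by ring
      _ ≤ L := hAL
  have hTL : T ≤ L := by
    calc T ≤ T * (2 * A * k * N) := Nat.le_mul_of_pos_right _ (by positivity)
      _ = 2 * A * k * T * N := by ring
      _ ≤ L := hAL
  have hNL : N ≤ L := Nat.le_mul_of_pos_left _ (by omega)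
  have hnL : (M + 3) * I.cmin ≤ L := by
    calc (M + 3) * I.cmin ≤ (2 * A) * N := Nat.mul_le_mul (by omega) hcN
      _ ≤ (2 * A) * N * (k * T) := Nat.le_mul_of_pos_right _ hkT
      _ = 2 * A * k * T * N := by ring
      _ ≤ L := hAL
  have hn'L : (k + 1) * M * I.cmin ≤ L := by
    calc (k + 1) * M * I.cmin ≤ (2 * k) * A * N :=
          Nat.mul_le_mul (Nat.mul_le_mul (by omega) (by omega)) hcN
      _ ≤ (2 * k) * A * N * T := Nat.le_mul_of_pos_right _ hT0
      _ = 2 * A * k * T * N := by ring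
      _ ≤ L := hAL
  have hL24 : 24 ≤ L := by omega
  have hNR : (0 : ℝ) < N := by exact_mod_cast hN0
  have hLR : (24 : ℝ) ≤ L := by exact_mod_cast hL24
  have hcR : (I.cmin : ℝ) ≤ N := by exact_mod_cast hcN
  have hNLR : (N : ℝ) ≤ L := by exact_mod_cast hNL
  have hNd : 2 ≤ N * I.dmin := hcd.trans (by gcongr)
  have hLd : 2 ≤ L * I.dmin := hNd.trans (by gcongr)
  -- the approximate baby distances stay bounded below
  have hη : (1 : ℝ) / 2 ^ m ≤ I.dmin / 2 := by
    have h1 : (L : ℝ) ^ 5 ≤ 2 ^ m := by exact_mod_cast hm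
    have h2 : (L : ℝ) ≤ 2 ^ m :=
      (le_self_pow₀ (by linarith) (by norm_num)).trans h1
    rw [div_le_div_iff₀ (by positivity) (by norm_num)]
    have : (L : ℝ) * I.dmin ≤ 2 ^ m * I.dmin := by gcongr
    linarith
  have hD : ∀ y, I.dmin / 2 ≤ D.baby y := by
    intro y
    have h1 := (abs_lt.1 (D.baby_lt y)).2
    have h2 := I.dmin_le y
    linarith
  have hcd1 : 1 ≤ I.cmin * (I.dmin / 2) := by linarith
  have hRp := I.R_pos
  have hn : 2 * I.R + 3 ≤ ((M + 3) * I.cmin : ℕ) * (I.dmin / 2) := by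
    push_cast
    rw [mul_assoc]
    have : ((M : ℝ) + 3) * 1 ≤ (M + 3) * (I.cmin * (I.dmin / 2)) := by gcongr
    linarith
  have hn' : (k + 1) * (I.R + 1) ≤ ((k + 1) * M * I.cmin : ℕ) * (I.dmin / 2) := by
    push_cast
    rw [mul_assoc, mul_assoc]
    have : (M : ℝ) * 1 ≤ M * (I.cmin * (I.dmin / 2)) := by gcongr
    gcongr
    linarith
  unfold EvaluatesCorrectly at hnot
  push Not at hnot
  obtain ⟨a, ha, b, hb, hab⟩ := hnot
  refine ⟨a, ha, ?_⟩
  set r : ℝ := (b : ℝ) / N + (j : ℝ) / L with hr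
  have hr0 : 0 ≤ r := by positivity
  have hrB : r * N ≤ B - 1 := by
    have h1 : (j : ℝ) / L * N ≤ 1 := by
      have : (j : ℝ) ≤ J := by exact_mod_cast hj.le
      have hLJ : (L : ℝ) = J * N := by rw [hL]; push_cast; ring
      rw [div_mul_eq_mul_div, div_le_one (by linarith), hLJ]
      gcongr
    have h2 : ((b + 2 : ℕ) : ℝ) ≤ B := by exact_mod_cast (by omega : b + 2 ≤ B)
    push_cast at h2
    have h3 : r * N = b + (j : ℝ) / L * N := by rw [hr]; field_simp
    linarith
  have hBhat : (B : ℝ) ≤ Rhat * N + 1 / 2 := by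
    have h0 : (0 : ℤ) ≤ round (Rhat * N) := by
      rw [round_eq]
      exact Int.floor_nonneg.2 (by have : 0 ≤ Rhat * N := by
                                     apply mul_nonneg <;> linarith
                                   linarith)
    have h1 : ((B : ℤ) : ℝ) = (round (Rhat * N) : ℤ) := by
      rw [hB, paramB, Int.toNat_of_nonneg h0]
    have h2 := abs_le.1 (abs_sub_round (Rhat * N))
    rw [← h1] at h2
    push_cast at h2
    linarith [h2.1]
  have hrT : r ≤ T * dk := by
    have h1 : Rhat ≤ T * dk := by rw [← div_le_iff₀ hdk]; exact Nat.le_ceil _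
    have h2 : r ≤ Rhat := by
      by_contra! hlt
      have := mul_lt_mul_of_pos_right hlt hNR
      linarith
    linarith
  obtain ⟨hred, happ⟩ := D.gApprox_spec (half_pos hdm) hD hn hk hn' hr0 hrT x a
  have herr := error_lt hL24 hm (a := a) (by omega) hTL hkL hnL hn'L
  by_contra! hgood
  suffices hfar : ∀ (y : X) (i : ℕ) (e : ℝ), (i : ℝ) / N ≤ I.babyDist y → |e| < 1 / (2 * L) →
      a • I.d x + (r : AddCircle I.R) ≠ I.d y + ((i / N + e : ℝ) : AddCircle I.R) by
    obtain ⟨p', hp', heq⟩ := D.exists_isFRep_of_far_from_boundary hN0 herr hred happ hfar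
    exact hab p' hp' heq
  intro y i e hi he heq
  set c : ℝ := (AddCircle.equivIco I.R 0 (I.d y - a • I.d x) : ℝ) with hc
  have hc1 : 0 ≤ c := (AddCircle.equivIco I.R 0 (I.d y - a • I.d x)).2.1
  have hc2 : c < I.R :=
    (AddCircle.equivIco I.R 0 (I.d y - a • I.d x)).2.2.trans_eq (zero_add I.R)
  have hcc : (c : AddCircle I.R) = I.d y - a • I.d x := AddCircle.coe_equivIco
  obtain ⟨l, hl⟩ := exists_int_mul_eq_of_add_coe_eq hcc heq
  have heN : |e| * N < 1 / 2 := by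
    calc |e| * N < 1 / (2 * L) * N := by gcongr
      _ ≤ 1 / (2 * L) * L := by gcongr
      _ = 1 / 2 := by field_simp
  have heN' := abs_le.1 (show |e| ≤ |e| from le_rfl)
  have heL : |e * L| < 1 / 2 := by
    rw [abs_mul, Nat.abs_cast]
    calc |e| * L < 1 / (2 * L) * L := by gcongr
      _ = 1 / 2 := by field_simp
  have hrR : r + |e| < I.R := by
    by_contra! hge
    have : I.R * N ≤ (r + |e|) * N := by gcongr
    rw [add_mul] at this
    linarith [hBR.2]
  have hdel := babyDist_add_dmin_le hX y (I := I)
  have hed : |e| < I.dmin := by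
    by_contra! hge
    have : I.dmin * N ≤ |e| * N := by gcongr
    linarith
  have hi0 : (0 : ℝ) ≤ (i : ℝ) / N := by positivity
  have hl1 : (l : ℝ) < 1 := by
    by_contra! hge
    have := mul_le_mul_of_nonneg_right hge hRp.le
    linarith
  have hl2 : (-2 : ℝ) < l := by
    by_contra! hle
    have := mul_le_mul_of_nonneg_right hle hRp.le
    linarith
  have hl1' : l < 1 := by exact_mod_cast hl1
  have hl2' : -2 < l := by exact_mod_cast hl2
  obtain ⟨w, hw2, hw⟩ : ∃ w : ℕ, w < 2 ∧ l = -w := ⟨(-l).toNat, by omega, by omega⟩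
  refine absurd (hgood y w hw2 (i - b)) (not_le.2 ?_)
  have hJL : (L : ℝ) = J * N := by rw [hL]; push_cast; ring
  have hjj : (j : ℝ) = L * (j / L) := by field_simp
  have : (j : ℝ) - (L : ℕ) * (c - (w : ℕ) * I.R) - ((i - b : ℤ) : ℝ) * J = e * L := by
    have h1 : (j : ℝ) / L = c - w * I.R + (i - b) / N + e := by
      rw [hw] at hl
      push_cast at hl
      rw [sub_div]
      linarith
    have h2 : (j : ℝ) = L * (c - w * I.R) + L * ((i - b) / N) + e * L := by
      rw [hjj, h1]; ring
    have h3 : (L : ℝ) * ((i - b) / N) = (i - b) * J := by rw [hJL]; field_simp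
    rw [h2, h3]
    push_cast
    ring
  rw [this]
  exact heL

/-- The evaluation of `g_N` is correct with probability at least `p`. -/
theorem le_evalProb (hX : 3 ≤ Nat.card X) {M q : ℕ} {Rhat : ℝ}
    (hE : I.GoodEstimate M Rhat) (hQ : I.GoodMultiplier M q Rhat) {k : ℕ} {dk : ℝ}
    (hk : I.SpansAtLeast k dk) {p : ℝ} (hp0 : 0 ≤ p) (hp1 : p < 1)
    (hm : I.paramL M q Rhat k dk p ^ 5 ≤ 2 ^ m) (x : X) :
    p ≤ D.evalProb k dk p M q Rhat x := by
  classical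
  have := Fintype.ofFinite X
  obtain ⟨hk0, hdk, -⟩ := id hk
  have hRpos := hE.three_mul_dmin_sub_le hX
  have hdm := I.dmin_pos
  have hT0 : 0 < ⌈Rhat / dk⌉₊ := Nat.ceil_pos.2 (div_pos (by linarith) hdk)
  have hTz : ((⌈Rhat / dk⌉ : ℤ) : ℝ) = (⌈Rhat / dk⌉₊ : ℝ) :=
    (natCast_ceil_eq_intCast_ceil (div_pos (by linarith) hdk).le).symm
  have hB6 := hQ.six_mul_le_paramB hX hE.two_le
  have hq := hQ.pos
  have hA0 : 0 < I.paramA M q Rhat :=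
    Nat.mul_pos (by have := hE.two_le; omega) (by omega)
  set T := ⌈Rhat / dk⌉₊ with hT
  set A := I.paramA M q Rhat with hA
  set J := I.paramJ M q Rhat k dk p with hJ
  have hp' : 0 < 1 - p := by linarith
  have hJ1 : 2 * (A : ℝ) * k * T / (1 - p) ≤ J := by
    rw [hJ, paramJ, hTz]; exact Nat.le_ceil _
  have hJ2 : 2 * (A : ℝ) * k * T ≤ J * (1 - p) := by rwa [div_le_iff₀ hp'] at hJ1
  have hJ3 : 2 * A * k * T ≤ J := by
    have : (J : ℝ) * (1 - p) ≤ J := mul_le_of_le_one_right (Nat.cast_nonneg _) (by linarith)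
    exact_mod_cast hJ2.trans this
  have hJ0 : 0 < J := lt_of_lt_of_le (by positivity) hJ3
  have hJR : (0 : ℝ) < J := by exact_mod_cast hJ0
  let P : ℕ → Prop := fun j => I.EvaluatesCorrectly x A (I.paramB q Rhat) (I.paramN q)
    (J * I.paramN q) j (D.gN k dk x (I.paramN q) (J * I.paramN q) j)
  let θ : ℕ × X × ℕ → ℝ := fun s => (J * I.paramN q : ℕ) *
    ((AddCircle.equivIco I.R 0 (I.d s.2.1 - s.1 • I.d x) : ℝ) - (s.2.2 : ℕ) * I.R)
  have hcov : (Finset.range J).filter (fun j => ¬ P j) ⊆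
      (Finset.range A ×ˢ (Finset.univ : Finset X) ×ˢ Finset.range 2).biUnion fun s =>
        (Finset.range J).filter fun j : ℕ => ∃ i : ℤ, |(j : ℝ) - θ s - i * J| < 1 / 2 := by
    intro j hj
    rw [Finset.mem_filter, Finset.mem_range] at hj
    obtain ⟨a, ha, y, w, hw, i, hi⟩ :=
      D.exists_near_of_not_evaluatesCorrectly hX hE hQ hk hJ3 hm x hj.1 hj.2
    rw [Finset.mem_biUnion]
    refine ⟨(a, y, w), by simpa [hw] using ha, ?_⟩
    rw [Finset.mem_filter, Finset.mem_range]
    exact ⟨hj.1, i, hi⟩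
  have hcard : ((Finset.range J).filter (fun j => ¬ P j)).card ≤ A * (Nat.card X * 2) := by
    refine (Finset.card_le_card hcov).trans (Finset.card_biUnion_le.trans ?_)
    refine (Finset.sum_le_card_nsmul _ _ 1 fun s _ =>
      card_filter_near_lattice_le_one J (θ s)).trans_eq ?_
    simp [Finset.card_product, Nat.card_eq_fintype_card]
  have hn := hE.card_le hX hk
  have hcardR : (((Finset.range J).filter (fun j => ¬ P j)).card : ℝ) ≤ J * (1 - p) := by
    refine le_trans ?_ hJ2
    have : A * (Nat.card X * 2) ≤ 2 * A * k * T := by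
      calc A * (Nat.card X * 2) ≤ A * (k * T * 2) := by gcongr
        _ = _ := by ring
    exact_mod_cast hcard.trans this
  have htot := Finset.card_filter_add_card_filter_not (s := Finset.range J) P
  rw [Finset.card_range] at htot
  have htotR : (((Finset.range J).filter P).card : ℝ) +
      ((Finset.range J).filter (fun j => ¬ P j)).card = J := by exact_mod_cast htot
  have heval : D.evalProb k dk p M q Rhat x =
      1 / (J : ℝ) * ((Finset.range J).filter P).card := by
    rw [Finset.card_filter]
    push_cast
    unfold evalProb paramL
    rfl
  rw [heval, one_div, ← div_eq_inv_mul, le_div_iff₀ hJR]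
  linarith

end ApproxDist

end Infrastructure

/-! ### Exponential sums over a fibre -/

/-- A sum of non-negative multiples of unit vectors in a sector is long. -/
theorem cos_mul_sum_le_norm_sum {ι : Type*} (S : Finset ι) {w φ : ι → ℝ} {c β : ℝ}
    (hw : ∀ i ∈ S, 0 ≤ w i) (hφ : ∀ i ∈ S, |φ i - c| ≤ β) (hβ : β ≤ Real.pi) :
    Real.cos β * ∑ i ∈ S, w i ≤ ‖∑ i ∈ S, (w i : ℂ) * Complex.exp (φ i * Complex.I)‖ := by
  have h1 : ‖∑ i ∈ S, (w i : ℂ) * Complex.exp (φ i * Complex.I)‖ =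
      ‖∑ i ∈ S, (w i : ℂ) * Complex.exp ((φ i - c : ℝ) * Complex.I)‖ := by
    have h2 : ∑ i ∈ S, (w i : ℂ) * Complex.exp ((φ i - c : ℝ) * Complex.I) =
        Complex.exp ((-c : ℝ) * Complex.I) *
          ∑ i ∈ S, (w i : ℂ) * Complex.exp (φ i * Complex.I) := by
      rw [Finset.mul_sum]
      refine Finset.sum_congr rfl fun i _ => ?_
      rw [mul_left_comm, ← Complex.exp_add]
      congr 2
      push_cast; ring
    rw [h2, norm_mul, Complex.norm_exp_ofReal_mul_I, one_mul]
  rw [h1]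
  refine le_trans ?_ (Complex.re_le_norm _)
  rw [Complex.re_sum, Finset.mul_sum]
  refine Finset.sum_le_sum fun i hi => ?_
  rw [Complex.re_ofReal_mul, Complex.exp_ofReal_mul_I_re, mul_comm]
  refine mul_le_mul_of_nonneg_left ?_ (hw i hi)
  rw [← Real.cos_abs (φ i - c)]
  exact Real.cos_le_cos_of_nonneg_of_le_pi (abs_nonneg _) hβ (hφ i hi)

theorem sq_card_le_two_mul_sum (T : Finset ℕ) :
    (T.card : ℝ) ^ 2 / 2 ≤ ∑ a ∈ T, ((a : ℝ) + 1 / 2) := by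
  induction T using Finset.induction_on_max with
  | empty => simp
  | insert a T hT ih =>
    have ha : a ∉ T := fun h => lt_irrefl _ (hT a h)
    rw [Finset.sum_insert ha, Finset.card_insert_of_notMem ha]
    have hc : T.card ≤ a := by
      have : T ⊆ Finset.range a := fun b hb => Finset.mem_range.2 (hT b hb)
      simpa using Finset.card_le_card this
    have hc' : (T.card : ℝ) ≤ a := by exact_mod_cast hc
    push_cast
    nlinarith

theorem two_mul_min_le_sin {u : ℝ} (h0 : 0 ≤ u) (h1 : u ≤ 1) :
    2 * min u (1 - u) ≤ Real.sin (Real.pi * u) := by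
  have hπ := Real.pi_pos
  have key : ∀ v : ℝ, 0 ≤ v → v ≤ 1 / 2 → 2 * v ≤ Real.sin (Real.pi * v) := by
    intro v hv hv'
    have := Real.mul_le_sin (x := Real.pi * v) (by positivity) (by nlinarith)
    rwa [← mul_assoc, div_mul_cancel₀ _ hπ.ne'] at this
  rcases le_total u (1 / 2) with h | h
  · exact (by gcongr; exact min_le_left _ _ : _ ≤ 2 * u).trans (key u h0 h)
  · refine (by gcongr; exact min_le_right _ _ : _ ≤ 2 * (1 - u)).trans
      ((key (1 - u) (by linarith) (by linarith)).trans_eq ?_)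
    rw [← Real.sin_pi_sub]
    congr 1; ring

/-- Among all sets of `n` residues the sum of `sin (π (a + 1/2) / A)` is smallest for a set
clustered at both ends, where it is still of order `n² / A`. -/
theorem sq_card_div_le_sum_sin {A : ℕ} (hA : 0 < A) (T : Finset ℕ) (hT : ∀ a ∈ T, a < A) :
    (T.card : ℝ) ^ 2 / (2 * A) ≤ ∑ a ∈ T, Real.sin (Real.pi * ((a + 1 / 2) / A)) := by
  classical
  have hAR : (0 : ℝ) < A := by exact_mod_cast hA
  set T₁ := T.filter (fun a => 2 * a + 1 ≤ A) with hT₁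
  set T₂ := T.filter (fun a => ¬ (2 * a + 1 ≤ A)) with hT₂
  have hmin : ∀ a ∈ T, 2 * (min ((a : ℝ) + 1 / 2) (A - (a + 1 / 2)) / A) ≤
      Real.sin (Real.pi * ((a + 1 / 2) / A)) := by
    intro a ha
    have h : ((a + 1 : ℕ) : ℝ) ≤ A := by exact_mod_cast hT a ha
    push_cast at h
    have := two_mul_min_le_sin (u := ((a : ℝ) + 1 / 2) / A) (by positivity)
      (by rw [div_le_one hAR]; linarith)
    rwa [one_sub_div hAR.ne', min_div_div_right hAR.le] at this
  have h1 : (T₁.card : ℝ) ^ 2 / 2 ≤ ∑ a ∈ T₁, min ((a : ℝ) + 1 / 2) (A - (a + 1 / 2)) := by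
    refine (sq_card_le_two_mul_sum T₁).trans (Finset.sum_le_sum fun a ha => ?_)
    have h : ((2 * a + 1 : ℕ) : ℝ) ≤ A := by exact_mod_cast (Finset.mem_filter.1 ha).2
    push_cast at h
    exact le_min le_rfl (by linarith)
  have h2 : (T₂.card : ℝ) ^ 2 / 2 ≤ ∑ a ∈ T₂, min ((a : ℝ) + 1 / 2) (A - (a + 1 / 2)) := by
    have hinj : Set.InjOn (fun a => A - 1 - a) T₂ := by
      intro a ha b hb hab
      have ha' := hT a (Finset.mem_filter.1 ha).1
      have hb' := hT b (Finset.mem_filter.1 hb).1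
      simp only at hab
      omega
    have := sq_card_le_two_mul_sum (T₂.image fun a => A - 1 - a)
    rw [Finset.card_image_of_injOn hinj, Finset.sum_image hinj] at this
    refine this.trans (Finset.sum_le_sum fun a ha => ?_)
    have h3 := hT a (Finset.mem_filter.1 ha).1
    have h4 : A ≤ 2 * a := by have := (Finset.mem_filter.1 ha).2; omega
    have h5 : ((A - 1 - a : ℕ) : ℝ) = A - 1 - a := by
      rw [Nat.cast_sub (by omega), Nat.cast_sub (by omega)]; simp
    have h6 : (A : ℝ) ≤ 2 * a := by exact_mod_cast h4
    rw [h5]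
    exact le_min (by linarith) (by linarith)
  have hcard : (T₁.card : ℝ) + T₂.card = T.card := by
    exact_mod_cast Finset.card_filter_add_card_filter_not (s := T) (fun a => 2 * a + 1 ≤ A)
  have hsum := Finset.sum_filter_add_sum_filter_not T (fun a => 2 * a + 1 ≤ A)
    (fun a => min ((a : ℝ) + 1 / 2) (A - (a + 1 / 2)))
  have h3 : (T.card : ℝ) ^ 2 / 4 ≤ ∑ a ∈ T, min ((a : ℝ) + 1 / 2) (A - (a + 1 / 2)) := by
    rw [← hsum, ← hcard]
    nlinarith [sq_nonneg ((T₁.card : ℝ) - T₂.card)]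
  calc (T.card : ℝ) ^ 2 / (2 * A) = 2 / A * ((T.card : ℝ) ^ 2 / 4) := by field_simp; norm_num
    _ ≤ 2 / A * ∑ a ∈ T, min ((a : ℝ) + 1 / 2) (A - (a + 1 / 2)) := by gcongr
    _ = ∑ a ∈ T, 2 * (min ((a : ℝ) + 1 / 2) (A - (a + 1 / 2)) / A) := by
        rw [Finset.mul_sum]; refine Finset.sum_congr rfl fun a _ => ?_; ring
    _ ≤ _ := Finset.sum_le_sum hmin

section FibreSum

variable {ι : Type*} {S : Finset ι} {A : ℕ} {a : ι → ℕ} {ν : ι → ℝ} {μ ν₀ β γ : ℝ}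

theorem abs_phase_sub_le (hA : 0 < A) {i : ι} (hlt : a i < A) (hμ : |μ| ≤ 1 / 4)
    (hν : |ν i - ν₀| ≤ β) :
    |2 * Real.pi * (a i * μ / A + ν i) - 2 * Real.pi * (μ / 2 + ν₀)| ≤
      Real.pi * (1 / 4 + 2 * β) := by
  have hAR : (0 : ℝ) < A := by exact_mod_cast hA
  have ha : (a i : ℝ) / A ≤ 1 := by
    rw [div_le_one hAR]; exact_mod_cast hlt.le
  have ha0 : (0 : ℝ) ≤ (a i : ℝ) / A := by positivity
  have h1 : |((a i : ℝ) / A - 1 / 2) * μ| ≤ 1 / 2 * (1 / 4) := by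
    rw [abs_mul]
    gcongr
    rw [abs_le]; constructor <;> linarith
  have h2 : 2 * Real.pi * (a i * μ / A + ν i) - 2 * Real.pi * (μ / 2 + ν₀) =
      2 * Real.pi * (((a i : ℝ) / A - 1 / 2) * μ + (ν i - ν₀)) := by ring
  have hπ : |2 * Real.pi| = 2 * Real.pi := abs_of_pos (by positivity)
  rw [h2, abs_mul, hπ]
  calc _ ≤ 2 * Real.pi * (1 / 2 * (1 / 4) + β) := by
        gcongr; exact (abs_add_le _ _).trans (add_le_add h1 hν)
    _ = _ := by ring

/-- A frequency within `1/4` of the target: the phases stay in one sector. -/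
theorem mul_card_le_norm_fibreSum (hA : 0 < A) (hlt : ∀ i ∈ S, a i < A) (hμ : |μ| ≤ 1 / 4)
    (hν : ∀ i ∈ S, |ν i - ν₀| ≤ β) (hβ : 1 / 4 + 2 * β ≤ 1)
    (hγ : γ ≤ Real.cos (Real.pi * (1 / 4 + 2 * β))) :
    γ * S.card ≤
      ‖∑ i ∈ S, Complex.exp ((2 * Real.pi * (a i * μ / A + ν i) : ℝ) * Complex.I)‖ := by
  have h := cos_mul_sum_le_norm_sum S (w := fun _ => 1) (φ := fun i =>
    2 * Real.pi * (a i * μ / A + ν i)) (c := 2 * Real.pi * (μ / 2 + ν₀)) (fun _ _ => zero_le_one)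
    (fun i hi => abs_phase_sub_le hA (hlt i hi) hμ (hν i hi))
    (mul_le_of_le_one_right Real.pi_pos.le hβ)
  simp only [Finset.sum_const, nsmul_eq_mul, mul_one, Complex.ofReal_one, one_mul] at h
  exact (mul_le_mul_of_nonneg_right hγ (Nat.cast_nonneg _)).trans h

/-- Two consecutive frequencies around the target. Their difference weights the vectors of the
fibre by `2 sin (π (a + 1/2) / A) ≥ 0` and replaces the two deviations by their mean. -/
theorem sq_le_norm_sq_add_norm_sq (hA : 0 < A) (hlt : ∀ i ∈ S, a i < A)
    (hinj : Set.InjOn a S) (hμ : |μ| ≤ 1 / 4)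
    (hν : ∀ i ∈ S, |ν i - ν₀| ≤ β) (hβ : 1 / 4 + 2 * β ≤ 1) (hγ0 : 0 ≤ γ)
    (hγ : γ ≤ Real.cos (Real.pi * (1 / 4 + 2 * β))) :
    γ ^ 2 * (S.card : ℝ) ^ 4 / (2 * A ^ 2) ≤
      ‖∑ i ∈ S, Complex.exp ((2 * Real.pi * (a i * (μ - 1 / 2) / A + ν i) : ℝ) * Complex.I)‖ ^ 2 +
      ‖∑ i ∈ S, Complex.exp ((2 * Real.pi * (a i * (μ + 1 / 2) / A + ν i) : ℝ) * Complex.I)‖ ^ 2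
      := by
  classical
  have hAR : (0 : ℝ) < A := by exact_mod_cast hA
  set w : ι → ℝ := fun i => Real.sin (Real.pi * ((a i + 1 / 2) / A)) with hw
  have hw0 : ∀ i ∈ S, 0 ≤ w i := by
    intro i hi
    have h : ((a i + 1 : ℕ) : ℝ) ≤ A := by exact_mod_cast hlt i hi
    push_cast at h
    refine Real.sin_nonneg_of_nonneg_of_le_pi (by positivity) ?_
    refine mul_le_of_le_one_right Real.pi_pos.le ?_
    rw [div_le_one hAR]; linarith
  have hwsum : (S.card : ℝ) ^ 2 / (2 * A) ≤ ∑ i ∈ S, w i := by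
    have h := sq_card_div_le_sum_sin hA (S.image a) (by simpa using hlt)
    rwa [Finset.card_image_of_injOn hinj, Finset.sum_image hinj] at h
  have hmain := cos_mul_sum_le_norm_sum S (w := w) (φ := fun i =>
    2 * Real.pi * (a i * μ / A + ν i)) (c := 2 * Real.pi * (μ / 2 + ν₀)) hw0
    (fun i hi => abs_phase_sub_le hA (hlt i hi) hμ (hν i hi))
    (mul_le_of_le_one_right Real.pi_pos.le hβ)
  set u := ∑ i ∈ S, Complex.exp ((2 * Real.pi * (a i * (μ - 1 / 2) / A + ν i) : ℝ) * Complex.I)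
    with hu
  set v := ∑ i ∈ S, Complex.exp ((2 * Real.pi * (a i * (μ + 1 / 2) / A + ν i) : ℝ) * Complex.I)
    with hv
  set ψ : ℝ := Real.pi / (2 * A) with hψ
  have hcomb : 2 * Complex.I *
      ∑ i ∈ S, (w i : ℂ) * Complex.exp ((2 * Real.pi * (a i * μ / A + ν i) : ℝ) * Complex.I) =
      Complex.exp (ψ * Complex.I) * v - Complex.exp ((-ψ : ℝ) * Complex.I) * u := by
    rw [hu, hv, Finset.mul_sum, Finset.mul_sum, Finset.mul_sum, ← Finset.sum_sub_distrib]
    refine Finset.sum_congr rfl fun i _ => ?_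
    rw [← Complex.exp_add, ← Complex.exp_add, hw]
    simp only
    rw [Complex.ofReal_sin, Complex.sin]
    set s : ℝ := Real.pi * ((a i + 1 / 2) / A) with hs
    set t : ℝ := 2 * Real.pi * (a i * μ / A + ν i) with ht
    have e1 : (ψ : ℂ) * Complex.I +
        ((2 * Real.pi * (a i * (μ + 1 / 2) / A + ν i) : ℝ) : ℂ) * Complex.I =
        (s : ℂ) * Complex.I + t * Complex.I := by
      rw [← add_mul, ← add_mul, ← Complex.ofReal_add, ← Complex.ofReal_add]
      congr 2
      rw [hψ, hs, ht]; field_simp; ring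
    have e2 : ((-ψ : ℝ) : ℂ) * Complex.I +
        ((2 * Real.pi * (a i * (μ - 1 / 2) / A + ν i) : ℝ) : ℂ) * Complex.I =
        -(s : ℂ) * Complex.I + t * Complex.I := by
      rw [← add_mul, ← add_mul, ← Complex.ofReal_neg, ← Complex.ofReal_add, ← Complex.ofReal_add]
      congr 2
      rw [hψ, hs, ht]; field_simp; ring
    rw [e1, e2, Complex.exp_add, Complex.exp_add]
    have hI : Complex.I * Complex.I = -1 := Complex.I_mul_I
    linear_combination (-(Complex.exp (s * Complex.I) * Complex.exp (t * Complex.I)) +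
      Complex.exp (-s * Complex.I) * Complex.exp (t * Complex.I)) * hI
  have hnorm : 2 * ‖∑ i ∈ S, (w i : ℂ) *
      Complex.exp ((2 * Real.pi * (a i * μ / A + ν i) : ℝ) * Complex.I)‖ ≤ ‖u‖ + ‖v‖ := by
    have h1 := congrArg norm hcomb
    rw [norm_mul, norm_mul, Complex.norm_I, Complex.norm_ofNat, mul_one] at h1
    rw [h1]
    refine (norm_sub_le _ _).trans ?_
    rw [norm_mul, norm_mul, Complex.norm_exp_ofReal_mul_I, Complex.norm_exp_ofReal_mul_I]
    linarith
  have hlow : γ * ((S.card : ℝ) ^ 2 / A) ≤ ‖u‖ + ‖v‖ := by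
    calc γ * ((S.card : ℝ) ^ 2 / A) = 2 * (γ * ((S.card : ℝ) ^ 2 / (2 * A))) := by
          field_simp
      _ ≤ 2 * (Real.cos (Real.pi * (1 / 4 + 2 * β)) * ∑ i ∈ S, w i) := by
          gcongr
          exact hγ0.trans hγ
      _ ≤ _ := le_trans (by gcongr) hnorm
  have hsq : (γ * ((S.card : ℝ) ^ 2 / A)) ^ 2 ≤ (‖u‖ + ‖v‖) ^ 2 := by
    gcongr
  have e : γ ^ 2 * (S.card : ℝ) ^ 4 / (2 * A ^ 2) = (γ * ((S.card : ℝ) ^ 2 / A)) ^ 2 / 2 := by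
    field_simp
  rw [e]
  nlinarith [sq_nonneg (‖u‖ - ‖v‖)]

end FibreSum

/-! ### Sampling probabilities -/

section Sampling

variable {Z : Type u} {A B : ℕ} {g : ℕ → ℕ → Z}

open Classical in
/-- The pairs `(a, b)` of the superposition at which `g` takes the value `z`. -/
noncomputable def fibre (A B : ℕ) (g : ℕ → ℕ → Z) (z : Z) : Finset (Fin A × Fin B) :=
  Finset.univ.filter fun ab => (ab.2 : ℕ) < B - 1 ∧ g ab.1 ab.2 = z

/-- The exponential sum over a fibre at the frequency `(h, k)`. -/
noncomputable def fibreSum (A B : ℕ) (g : ℕ → ℕ → Z) (z : Z) (h k : ℕ) : ℂ :=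
  ∑ ab ∈ fibre A B g z, Complex.exp
    ((2 * Real.pi * ((ab.1 : ℕ) * h / A + (ab.2 : ℕ) * k / B) : ℝ) * Complex.I)

theorem fourierTransform_fibreState (hk : Fin A × Fin B) (z : Z) :
    fourierTransform A B (fibreState A B g) hk z =
      (1 / (Real.sqrt ((A : ℝ) * B) * Real.sqrt ((A : ℝ) * (B - 1 : ℕ))) : ℝ) *
        fibreSum A B g z hk.1 hk.2 := by
  classical
  unfold fourierTransform fibreState fibreSum fibre
  rw [Finset.sum_filter, Finset.mul_sum, Finset.mul_sum]
  refine Finset.sum_congr rfl fun ab _ => ?_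
  rw [← Complex.exp_add]
  split_ifs with h
  · have e : 2 * (Real.pi : ℂ) * Complex.I * (((ab.1 : ℕ) : ℂ) * ((hk.1 : ℕ) : ℂ) / A) +
        2 * Real.pi * Complex.I * (((ab.2 : ℕ) : ℂ) * ((hk.2 : ℕ) : ℂ) / B) =
        ((2 * Real.pi * ((ab.1 : ℕ) * (hk.1 : ℕ) / A + (ab.2 : ℕ) * (hk.2 : ℕ) / B) : ℝ) : ℂ) *
          Complex.I := by
      push_cast; ring
    rw [e]
    push_cast
    ring
  · simp

theorem norm_fourierTransform_sq (hk : Fin A × Fin B) (z : Z) :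
    ‖fourierTransform A B (fibreState A B g) hk z‖ ^ 2 =
      1 / ((A : ℝ) ^ 2 * B * (B - 1 : ℕ)) * ‖fibreSum A B g z hk.1 hk.2‖ ^ 2 := by
  rw [fourierTransform_fibreState, norm_mul, mul_pow, Complex.norm_real, Real.norm_eq_abs, sq_abs,
    div_pow, mul_pow, Real.sq_sqrt (by positivity), Real.sq_sqrt (by positivity), one_pow]
  congr 2
  ring

theorem sampleProb_eq_sum (Y : Finset Z) (hY : ∀ a < A, ∀ b < B - 1, g a b ∈ Y)
    (hk : Fin A × Fin B) :
    sampleProb A B g hk =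
      1 / ((A : ℝ) ^ 2 * B * (B - 1 : ℕ)) * ∑ z ∈ Y, ‖fibreSum A B g z hk.1 hk.2‖ ^ 2 := by
  unfold sampleProb
  rw [tsum_eq_sum (s := Y), Finset.mul_sum]
  · exact Finset.sum_congr rfl fun z _ => norm_fourierTransform_sq hk z
  · intro z hz
    have : fibre A B g z = ∅ := by
      classical
      refine Finset.filter_eq_empty_iff.2 fun ab _ h => hz ?_
      rw [← h.2]
      exact hY _ ab.1.2 _ h.1
    rw [norm_fourierTransform_sq, fibreSum, this]
    simp

theorem sampleProb_nonneg (hk : Fin A × Fin B) : 0 ≤ sampleProb A B g hk :=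
  tsum_nonneg fun _ => sq_nonneg _

theorem sum_card_fibre (Y : Finset Z) (hY : ∀ a < A, ∀ b < B - 1, g a b ∈ Y) :
    ∑ z ∈ Y, ((fibre A B g z).card : ℝ) = A * (B - 1 : ℕ) := by
  classical
  have h := Finset.card_eq_sum_card_fiberwise (f := fun ab : Fin A × Fin B => g ab.1 ab.2)
    (s := Finset.univ.filter fun ab : Fin A × Fin B => (ab.2 : ℕ) < B - 1) (t := Y)
    (fun ab hab => hY _ ab.1.2 _ (by simpa using hab))
  have hcard : (Finset.univ.filter fun ab : Fin A × Fin B => (ab.2 : ℕ) < B - 1).card =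
      A * (B - 1) := by
    have : (Finset.univ.filter fun ab : Fin A × Fin B => (ab.2 : ℕ) < B - 1) =
        Finset.univ ×ˢ (Finset.univ.filter fun b : Fin B => (b : ℕ) < B - 1) := by
      ext ⟨a, b⟩; simp
    rw [this, Finset.card_product, Finset.card_univ, Fintype.card_fin,
      Fin.card_filter_val_lt, min_eq_right (Nat.sub_le _ _)]
  rw [hcard] at h
  have h2 : (A : ℝ) * (B - 1 : ℕ) = ((A * (B - 1) : ℕ) : ℝ) := by push_cast; ring
  rw [h2, h]
  push_cast
  refine Finset.sum_congr rfl fun z _ => ?_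
  unfold fibre
  rw [Finset.filter_filter]

/-- Power mean inequality for the fibre sizes. -/
theorem le_sum_card_fibre_pow_four (hB : 2 ≤ B) (Y : Finset Z)
    (hY : ∀ a < A, ∀ b < B - 1, g a b ∈ Y) (hcard : (Y.card : ℝ) ≤ 2 * (B - 1 : ℕ)) :
    (A : ℝ) ^ 4 * (B - 1 : ℕ) / 8 ≤ ∑ z ∈ Y, ((fibre A B g z).card : ℝ) ^ 4 := by
  have hb : (0 : ℝ) < (B - 1 : ℕ) := by exact_mod_cast (by omega : 0 < B - 1)
  rcases Y.eq_empty_or_nonempty with rfl | hne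
  · have h := sum_card_fibre ∅ hY
    rw [Finset.sum_empty] at h
    have hA : (A : ℝ) = 0 := by
      rcases mul_eq_zero.1 h.symm with h | h
      · exact h
      · exact absurd h hb.ne'
    simp [hA]
  have hc : (0 : ℝ) < Y.card := by exact_mod_cast hne.card_pos
  have h := pow_sum_div_card_le_sum_pow (s := Y) (f := fun z => ((fibre A B g z).card : ℝ))
    (fun _ _ => Nat.cast_nonneg _) 3
  rw [sum_card_fibre Y hY] at h
  refine le_trans ?_ h
  rw [div_le_div_iff₀ (by norm_num) (by positivity)]
  calc (A : ℝ) ^ 4 * (B - 1 : ℕ) * (Y.card : ℝ) ^ 3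
      ≤ (A : ℝ) ^ 4 * (B - 1 : ℕ) * (2 * (B - 1 : ℕ)) ^ 3 := by gcongr
    _ = _ := by ring

/-- `g` behaves like the quantization of a homomorphism `(a, b) ↦ aτ + b` from `ℤ × ℤ` to the
circle `ℝ / ωℤ`: on every fibre, `b` is the integer that makes `aτ + b` fall into a fixed cell
`[c, c + 1)` of this circle. -/
def IsQuantizedHom (A B : ℕ) (g : ℕ → ℕ → Z) (τ ω : ℝ) : Prop :=
  ∀ z, ∃ c : ℝ, ∀ a < A, ∀ b < B - 1, g a b = z →
    ∃ (l : ℤ) (f : ℝ), 0 ≤ f ∧ f < 1 ∧ (b : ℝ) = c - a * τ + f + l * ω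

/-- The range `b ≤ B - 2` is too short to wrap around, so a fibre contains at most one `b` for each
`a`. -/
theorem IsQuantizedHom.injOn_fst {τ ω : ℝ} (hg : IsQuantizedHom A B g τ ω)
    (hω : |(B : ℝ) - ω| ≤ 1 / 4) (hB : 6 ≤ B) (z : Z) :
    Set.InjOn (fun ab : Fin A × Fin B => (ab.1 : ℕ)) (fibre A B g z) := by
  classical
  obtain ⟨c, hc⟩ := hg z
  rintro ⟨a, b⟩ hab ⟨a', b'⟩ hab' haa
  simp only [fibre, Finset.coe_filter, Finset.mem_univ, true_and, Set.mem_ofPred_eq] at hab hab'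
  simp only at haa
  obtain ⟨l, f, hf0, hf1, hb⟩ := hc a a.2 b hab.1 hab.2
  obtain ⟨l', f', hf0', hf1', hb'⟩ := hc a' a'.2 b' hab'.1 hab'.2
  have hω' := abs_le.1 hω
  have hBR : (6 : ℝ) ≤ B := by exact_mod_cast hB
  have h1 : ((b : ℕ) + 2 : ℝ) ≤ B := by exact_mod_cast (by omega : (b : ℕ) + 2 ≤ B)
  have h2 : ((b' : ℕ) + 2 : ℝ) ≤ B := by exact_mod_cast (by omega : (b' : ℕ) + 2 ≤ B)
  have h3 : (0 : ℝ) ≤ (b : ℕ) := Nat.cast_nonneg _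
  have h4 : (0 : ℝ) ≤ (b' : ℕ) := Nat.cast_nonneg _
  rw [haa] at hb
  have hdiff : ((b : ℕ) : ℝ) - (b' : ℕ) = (f - f') + ((l - l' : ℤ) : ℝ) * ω := by
    rw [hb, hb']; push_cast; ring
  have hll : l - l' = 0 := by
    by_contra hne
    rcases lt_or_gt_of_ne hne with h | h
    · have h5 : ((l - l' : ℤ) : ℝ) ≤ -1 := by exact_mod_cast (by omega : l - l' ≤ -1)
      have := mul_le_mul_of_nonneg_right h5 (show (0 : ℝ) ≤ ω by linarith)
      linarith
    · have h5 : (1 : ℝ) ≤ ((l - l' : ℤ) : ℝ) := by exact_mod_cast (by omega : 1 ≤ l - l')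
      have := mul_le_mul_of_nonneg_right h5 (show (0 : ℝ) ≤ ω by linarith)
      linarith
  rw [hll] at hdiff
  have hbb : (b : ℕ) = (b' : ℕ) := by
    have h5 : ((b : ℕ) : ℝ) < (b' : ℕ) + 1 := by push_cast at hdiff; linarith
    have h6 : ((b' : ℕ) : ℝ) < (b : ℕ) + 1 := by push_cast at hdiff; linarith
    have h5' : (b : ℕ) < (b' : ℕ) + 1 := by exact_mod_cast h5
    have h6' : (b' : ℕ) < (b : ℕ) + 1 := by exact_mod_cast h6
    omega
  exact Prod.ext (Fin.ext haa) (Fin.ext hbb)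

/-- Up to multiples of `B`, the second register is an affine function of the first one on every
fibre, with an error that varies in an interval of length `1.3`. -/
theorem IsQuantizedHom.exists_affine {τ ω : ℝ} (hg : IsQuantizedHom A B g τ ω)
    (hω : |(B : ℝ) - ω| ≤ 1 / 4) (hω6 : 6 ≤ ω) (z : Z) :
    ∃ c : ℝ, ∀ a < A, ∀ b < B - 1, g a b = z →
      ∃ (l : ℤ) (v : ℝ), |v| ≤ 13 / 20 ∧ (b : ℝ) = l * B - a * (B * τ / ω) + c + v := by
  obtain ⟨c, hc⟩ := hg z
  have hω' := abs_le.1 hω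
  have hω0 : 0 < ω := by linarith
  have hBR : (0 : ℝ) < B := by linarith
  set ρ : ℝ := B / ω with hρ
  have hρ0 : 0 < ρ := by positivity
  have hρω : ρ * ω = B := by rw [hρ]; field_simp
  have hρ1 : ρ ≤ 25 / 24 := by
    rw [hρ, div_le_iff₀ hω0]
    linarith
  -- the centre of the interval in which the error varies
  set c₀ : ℝ := if ρ ≤ 1 then 5 / 8 else 19 / 48 with hc₀
  refine ⟨ρ * c + c₀, fun a ha b hb hab => ?_⟩
  obtain ⟨l, f, hf0, hf1, h⟩ := hc a ha b hb hab
  refine ⟨l, b * (1 - ρ) + ρ * f - c₀, ?_, ?_⟩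
  · have hb2 : ((b : ℕ) + 2 : ℝ) ≤ B := by exact_mod_cast (by omega : b + 2 ≤ B)
    have hb0 : (0 : ℝ) ≤ b := Nat.cast_nonneg _
    have hbω : (b : ℝ) / ω ≤ 1 := by rw [div_le_one hω0]; linarith
    have hbω0 : (0 : ℝ) ≤ (b : ℝ) / ω := by positivity
    have heq : (b : ℝ) * (1 - ρ) = (b : ℝ) / ω * (ω - B) := by rw [hρ]; field_simp
    have hf : 0 ≤ ρ * f := by positivity
    have hf' : ρ * f ≤ ρ := mul_le_of_le_one_right hρ0.le hf1.le
    rw [abs_le]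
    by_cases hle : ρ ≤ 1
    · have hBω : 0 ≤ ω - B := by
        have := (div_le_one hω0).1 hle
        linarith
      have h1 : (b : ℝ) / ω * (ω - B) ≤ 1 * (1 / 4) := by gcongr; linarith
      have h2 : 0 ≤ (b : ℝ) / ω * (ω - B) := by positivity
      rw [hc₀, if_pos hle, heq]
      constructor <;> linarith
    · have hBω : 0 ≤ B - ω := by
        have := (one_lt_div hω0).1 (not_le.1 hle)
        linarith
      have h1 : (b : ℝ) / ω * (B - ω) ≤ 1 * (1 / 4) := by gcongr; linarith
      have h2 : 0 ≤ (b : ℝ) / ω * (B - ω) := by positivity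
      rw [hc₀, if_neg hle, heq]
      constructor <;> nlinarith
  · have h1 : ρ * b = ρ * c - a * (B * τ / ω) + ρ * f + l * B := by
      rw [h, ← hρω, hρ]
      field_simp
    linarith

/-- The outcomes `h` that lie within `1` of the target `θ` modulo `A`. -/
def NearTarget (A : ℕ) (θ : ℝ) (h : ℕ) : Prop := ∃ w : ℤ, |(h : ℝ) + w * A - θ| ≤ 1

/-- The phases in a fibre sum: `n` may be any integer congruent to `h` modulo `A`. -/
theorem IsQuantizedHom.exists_fibreSum_eq {τ ω : ℝ} (hg : IsQuantizedHom A B g τ ω)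
    (hω : |(B : ℝ) - ω| ≤ 1 / 4) (hω6 : 6 ≤ ω) (hA : 0 < A) (k : ℕ) (z : Z) :
    ∃ (ν : Fin A × Fin B → ℝ) (ν₀ : ℝ),
      (∀ ab ∈ fibre A B g z, |ν ab - ν₀| ≤ 13 / 20 * k / B) ∧
      ∀ (h : ℕ) (w : ℤ), fibreSum A B g z h k =
        ∑ ab ∈ fibre A B g z, Complex.exp
          ((2 * Real.pi * ((ab.1 : ℕ) * ((h : ℝ) + w * A - A * k * τ / ω) / A + ν ab) : ℝ) *
            Complex.I) := by
  classical
  have hAR : (0 : ℝ) < A := by exact_mod_cast hA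
  have hω0 : 0 < ω := by linarith
  have hBR : (0 : ℝ) < B := by linarith [(abs_le.1 hω).1]
  obtain ⟨c, hc⟩ := hg.exists_affine hω hω6 z
  have hex : ∀ ab : Fin A × Fin B, ∃ lv : ℤ × ℝ, ab ∈ fibre A B g z →
      |lv.2| ≤ 13 / 20 ∧ ((ab.2 : ℕ) : ℝ) =
        lv.1 * B - (ab.1 : ℕ) * (B * τ / ω) + c + lv.2 := by
    intro ab
    by_cases hab : ab ∈ fibre A B g z
    · have hab' := (Finset.mem_filter.1 hab).2
      obtain ⟨l, v, h1, h2⟩ := hc ab.1 ab.1.2 ab.2 hab'.1 hab'.2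
      exact ⟨(l, v), fun _ => ⟨h1, h2⟩⟩
    · exact ⟨(0, 0), fun h => absurd h hab⟩
  choose lv hlv using hex
  refine ⟨fun ab => (c + (lv ab).2) * k / B, c * k / B, ?_, ?_⟩
  · intro ab hab
    have : (c + (lv ab).2) * k / B - c * k / B = (lv ab).2 * (k / B) := by ring
    rw [this, abs_mul, abs_of_nonneg (show (0 : ℝ) ≤ k / B by positivity), mul_div_assoc]
    gcongr
    exact (hlv ab hab).1
  · intro h w
    refine Finset.sum_congr rfl fun ab hab => ?_
    rw [Complex.exp_eq_exp_iff_exists_int]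
    refine ⟨(lv ab).1 * k - (ab.1 : ℕ) * w, ?_⟩
    have hR : 2 * Real.pi * ((ab.1 : ℕ) * h / A + (ab.2 : ℕ) * k / B : ℝ) =
        2 * Real.pi * ((ab.1 : ℕ) * ((h : ℝ) + w * A - A * k * τ / ω) / A +
          (c + (lv ab).2) * k / B) + ((lv ab).1 * k - (ab.1 : ℕ) * w) * (2 * Real.pi) := by
      rw [(hlv ab hab).2]
      field_simp
      ring
    rw [hR]
    push_cast
    ring

/-- For each `k` the outcomes near the target together have probability `Ω(1/B)`. -/
theorem IsQuantizedHom.le_sum_sampleProb {τ ω : ℝ} (hg : IsQuantizedHom A B g τ ω)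
    (hω : |(B : ℝ) - ω| ≤ 1 / 4) (hω6 : 6 ≤ ω) (hA : 2 ≤ A) (hB : 6 ≤ B) (Y : Finset Z)
    (hY : ∀ a < A, ∀ b < B - 1, g a b ∈ Y) (hcard : (Y.card : ℝ) ≤ 2 * (B - 1 : ℕ))
    {γ : ℝ} (hγ0 : 0 ≤ γ) {k : Fin B} {β : ℝ} (hkβ : 13 / 20 * (k : ℕ) / B ≤ β)
    (hβ : 1 / 4 + 2 * β ≤ 1) (hγ : γ ≤ Real.cos (Real.pi * (1 / 4 + 2 * β)))
    {θ : ℝ} (hθ : θ = A * (k : ℕ) * τ / ω)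
    [DecidablePred fun h : Fin A => NearTarget A θ h] :
    γ ^ 2 / (16 * B) ≤
      ∑ h ∈ Finset.univ.filter (fun h : Fin A => NearTarget A θ h),
        sampleProb A B g (h, k) := by
  have hA0 : 0 < A := by omega
  have hAR : (0 : ℝ) < A := by exact_mod_cast hA0
  have hBR : (6 : ℝ) ≤ B := by exact_mod_cast hB
  have hb0 : (0 : ℝ) < (B - 1 : ℕ) := by exact_mod_cast (by omega : 0 < B - 1)
  -- it suffices to bound the exponential sums of each fibre
  have key : ∀ s : Finset (Fin A), (∀ h ∈ s, NearTarget A θ h) →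
      (∀ z ∈ Y, γ ^ 2 * ((fibre A B g z).card : ℝ) ^ 4 / (2 * A ^ 2) ≤
        ∑ h ∈ s, ‖fibreSum A B g z h k‖ ^ 2) →
      γ ^ 2 / (16 * B) ≤ ∑ h ∈ Finset.univ.filter (fun h : Fin A => NearTarget A θ h),
        sampleProb A B g (h, k) := by
    intro s hs hz
    calc γ ^ 2 / (16 * B) = 1 / ((A : ℝ) ^ 2 * B * (B - 1 : ℕ)) *
          (γ ^ 2 / (2 * A ^ 2) * ((A : ℝ) ^ 4 * (B - 1 : ℕ) / 8)) := by
          field_simp; ring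
      _ ≤ 1 / ((A : ℝ) ^ 2 * B * (B - 1 : ℕ)) *
          (γ ^ 2 / (2 * A ^ 2) * ∑ z ∈ Y, ((fibre A B g z).card : ℝ) ^ 4) := by
          gcongr
          exact le_sum_card_fibre_pow_four (by omega) Y hY hcard
      _ = 1 / ((A : ℝ) ^ 2 * B * (B - 1 : ℕ)) *
          ∑ z ∈ Y, γ ^ 2 * ((fibre A B g z).card : ℝ) ^ 4 / (2 * A ^ 2) := by
          rw [Finset.mul_sum]
          congr 1
          exact Finset.sum_congr rfl fun z _ => by ring
      _ ≤ 1 / ((A : ℝ) ^ 2 * B * (B - 1 : ℕ)) *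
          ∑ z ∈ Y, ∑ h ∈ s, ‖fibreSum A B g z h k‖ ^ 2 := by
          gcongr with z hzY
          exact hz z hzY
      _ = ∑ h ∈ s, sampleProb A B g (h, k) := by
          rw [Finset.sum_comm, Finset.mul_sum]
          exact Finset.sum_congr rfl fun h _ => (sampleProb_eq_sum Y hY (h, k)).symm
      _ ≤ _ := Finset.sum_le_sum_of_subset_of_nonneg
          (fun h hh => Finset.mem_filter.2 ⟨Finset.mem_univ _, hs h hh⟩)
          (fun _ _ _ => sampleProb_nonneg _)
  -- the residue of an integer modulo `A`
  have hmod : ∀ n : ℤ, ∃ (h : Fin A) (w : ℤ), ((h : ℕ) : ℝ) + w * A = n := by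
    intro n
    have hA' : (0 : ℤ) < A := by exact_mod_cast hA0
    have h0 := Int.emod_nonneg n hA'.ne'
    have h1 := Int.emod_lt_of_pos n hA'
    refine ⟨⟨(n % A).toNat, by omega⟩, n / A, ?_⟩
    have h2 : (((n % A).toNat : ℕ) : ℤ) + n / A * A = n := by
      rw [Int.toNat_of_nonneg h0, mul_comm]; exact Int.emod_add_mul_ediv n A
    exact_mod_cast h2
  have hlt : ∀ z, ∀ ab ∈ fibre A B g z, ((ab.1 : Fin A) : ℕ) < A := fun _ ab _ => ab.1.2
  by_cases hnear : |(round θ : ℝ) - θ| ≤ 1 / 4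
  · obtain ⟨h, w, hh⟩ := hmod (round θ)
    refine key {h} ?_ ?_
    · intro h' hh'
      rw [Finset.mem_singleton] at hh'
      subst hh'
      exact ⟨w, by rw [hh]; linarith⟩
    · intro z _
      rw [Finset.sum_singleton]
      obtain ⟨ν, ν₀, hν, hsum⟩ := hg.exists_fibreSum_eq hω hω6 hA0 k z
      rw [hsum h w, ← hθ, hh]
      have h1 := mul_card_le_norm_fibreSum hA0 (hlt z) hnear
        (fun ab hab => (hν ab hab).trans hkβ) hβ hγ
      have hcA : ((fibre A B g z).card : ℝ) ≤ A := by
        have h2 := Finset.card_le_card_of_injOn (s := fibre A B g z) (t := Finset.range A)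
          (fun ab => (ab.1 : ℕ)) (fun ab _ => by simp) (hg.injOn_fst hω hB z)
        rw [Finset.card_range] at h2
        exact_mod_cast h2
      calc γ ^ 2 * ((fibre A B g z).card : ℝ) ^ 4 / (2 * A ^ 2)
          = (γ * (fibre A B g z).card) ^ 2 * ((fibre A B g z).card ^ 2 / (2 * A ^ 2)) := by ring
        _ ≤ (γ * (fibre A B g z).card) ^ 2 * 1 := by
            gcongr
            rw [div_le_one (by positivity)]
            have : ((fibre A B g z).card : ℝ) ^ 2 ≤ (A : ℝ) ^ 2 := by gcongr
            nlinarith [sq_nonneg (A : ℝ)]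
        _ ≤ _ := by
            rw [mul_one]
            gcongr
  · have hfl1 := Int.floor_le θ
    have hfl2 := Int.lt_floor_add_one θ
    -- neither neighbour is within `1/4`, so the mean deviation is at most `1/4`
    have hμ : |(⌊θ⌋ : ℝ) + 1 / 2 - θ| ≤ 1 / 4 := by
      by_contra! hlt'
      apply hnear
      have habs := lt_abs.1 hlt'
      rcases habs with h | h
      · have hr : round θ = ⌊θ⌋ := by
          rw [round_eq, Int.floor_eq_iff]
          constructor <;> linarith
        rw [hr, abs_le]
        constructor <;> linarith
      · have hr : round θ = ⌊θ⌋ + 1 := by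
          rw [round_eq, Int.floor_eq_iff]
          push_cast
          constructor <;> linarith
        rw [hr, abs_le]
        push_cast
        constructor <;> linarith
    obtain ⟨h₁, w₁, hh₁⟩ := hmod ⌊θ⌋
    obtain ⟨h₂, w₂, hh₂⟩ := hmod (⌊θ⌋ + 1)
    push_cast at hh₂
    have hne : h₁ ≠ h₂ := by
      rintro rfl
      have h1 : ((w₂ - w₁ : ℤ) : ℝ) * A = 1 := by push_cast; linarith
      have h2 : (w₂ - w₁) * (A : ℤ) = 1 := by exact_mod_cast h1
      have h3 := Int.eq_one_or_neg_one_of_mul_eq_one (by rw [mul_comm] at h2; exact h2)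
      omega
    refine key {h₁, h₂} ?_ ?_
    · intro h hh
      rw [Finset.mem_insert, Finset.mem_singleton] at hh
      rcases hh with rfl | rfl
      · exact ⟨w₁, by rw [hh₁, abs_le]; constructor <;> linarith⟩
      · exact ⟨w₂, by rw [hh₂, abs_le]; constructor <;> linarith⟩
    · intro z _
      rw [Finset.sum_pair hne]
      obtain ⟨ν, ν₀, hν, hsum⟩ := hg.exists_fibreSum_eq hω hω6 hA0 k z
      rw [hsum h₁ w₁, hsum h₂ w₂, ← hθ, hh₁, hh₂]
      have h1 := sq_le_norm_sq_add_norm_sq hA0 (hlt z) (hg.injOn_fst hω hB z) hμ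
        (fun ab hab => (hν ab hab).trans hkβ) hβ hγ0 hγ
      have e1 : (⌊θ⌋ : ℝ) + 1 / 2 - θ - 1 / 2 = ⌊θ⌋ - θ := by ring
      have e2 : (⌊θ⌋ : ℝ) + 1 / 2 - θ + 1 / 2 = ⌊θ⌋ + 1 - θ := by ring
      rw [e1, e2] at h1
      exact h1

end Sampling

namespace Infrastructure

variable {X : Type u} [Finite X] {I : Infrastructure X}

/-! ### The quantized function of an infrastructure -/

theorem EvaluatesCorrectly.isQuantizedHom {x : X} {A B N L j : ℕ} {g : ℕ → ℕ → X × ℤ}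
    (h : I.EvaluatesCorrectly x A B N L j g) (hN : 0 < N) :
    IsQuantizedHom A B g (N * I.dist x) (I.R * N) := by
  rintro ⟨y, i⟩
  have hNR : (0 : ℝ) < N := by exact_mod_cast hN
  refine ⟨N * I.dist y + i - N * (j / L), fun a ha b hb hab => ?_⟩
  obtain ⟨⟨y', f⟩, ⟨hf0, hf1, heq⟩, hg⟩ := h a ha b hb
  rw [hab] at hg
  obtain ⟨rfl, rfl⟩ := Prod.mk.inj hg
  simp only at hf0 hf1 heq
  obtain ⟨l, hl⟩ : ∃ l : ℤ, (l : ℝ) * I.R =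
      ((b : ℝ) / N + j / L) - ((I.dist y - a * I.dist x) + f) := by
    refine exists_int_mul_eq_of_add_coe_eq (u := I.d y) (v := a • I.d x) ?_ heq.symm
    rw [AddCircle.coe_sub, I.coe_dist, ← nsmul_eq_mul, AddCircle.coe_nsmul, I.coe_dist]
  refine ⟨l, f * N - ⌊f * N⌋, sub_nonneg.2 (Int.floor_le _),
    by linarith [Int.lt_floor_add_one (f * N)], ?_⟩
  have h1 : (b : ℝ) = N * (b / N) := by field_simp
  have h2 : (b : ℝ) / N = l * I.R - j / L + (I.dist y - a * I.dist x) + f := by linarith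
  rw [h1, h2]
  ring

/-- The cells into which the arcs between consecutive elements are divided. -/
theorem EvaluatesCorrectly.exists_range {x : X} {A B N L j : ℕ} {g : ℕ → ℕ → X × ℤ}
    (h : I.EvaluatesCorrectly x A B N L j g) (hN : 0 < N) :
    ∃ Y : Finset (X × ℤ), (∀ a < A, ∀ b < B - 1, g a b ∈ Y) ∧
      (Y.card : ℝ) ≤ I.R * N + Nat.card X := by
  classical
  have := Fintype.ofFinite X
  refine ⟨Finset.univ.biUnion fun y : X =>
    (Finset.range ⌈I.babyDist y * N⌉₊).image fun i : ℕ => (y, (i : ℤ)), ?_, ?_⟩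
  · intro a ha b hb
    obtain ⟨⟨y, f⟩, ⟨hf0, hf1, -⟩, hg⟩ := h a ha b hb
    simp only at hf0 hf1 hg
    rw [hg, Finset.mem_biUnion]
    refine ⟨y, Finset.mem_univ _, ?_⟩
    have hfN : 0 ≤ f * N := by positivity
    rw [Finset.mem_image]
    refine ⟨⌊f * N⌋₊, ?_, by rw [Int.natCast_floor_eq_floor hfN]⟩
    rw [Finset.mem_range]
    have hNR : (0 : ℝ) < N := by exact_mod_cast hN
    rw [Nat.floor_lt hfN]
    calc f * N < I.babyDist y * N := by gcongr
      _ ≤ _ := Nat.le_ceil _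
  · calc _ ≤ ((∑ y : X, ((Finset.range ⌈I.babyDist y * N⌉₊).image
            fun i : ℕ => (y, (i : ℤ))).card : ℕ) : ℝ) := by
          exact_mod_cast Finset.card_biUnion_le
      _ ≤ ∑ y : X, (I.babyDist y * N + 1) := by
          push_cast
          refine Finset.sum_le_sum fun y _ => ?_
          refine le_trans ?_ (Nat.ceil_lt_add_one
            (mul_nonneg (I.babyDist_pos y).le (Nat.cast_nonneg N))).le
          have := Finset.card_image_le (s := Finset.range ⌈I.babyDist y * N⌉₊)
            (f := fun i : ℕ => (y, (i : ℤ)))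
          rw [Finset.card_range] at this
          exact_mod_cast this
      _ = (∑ y : X, I.babyDist y) * N + Nat.card X := by
          rw [Finset.sum_add_distrib, ← Finset.sum_mul]
          simp [Nat.card_eq_fintype_card]
      _ ≤ _ := by
          gcongr
          exact I.sum_babyDist_le

/-! ### Classical post-processing -/

theorem norm_coe_sub_d_le {x : X} {v e : ℝ} {l : ℤ} (hv : v = I.dist x + e - l * I.R) :
    ‖(v : AddCircle I.R) - I.d x‖ ≤ |e| := by
  have : (v : AddCircle I.R) - I.d x = (e : AddCircle I.R) := by
    have h0 : ((l * I.R : ℝ) : AddCircle I.R) = 0 :=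
      (AddCircle.coe_eq_zero_iff _).2 ⟨l, by rw [zsmul_eq_mul]⟩
    rw [hv, AddCircle.coe_sub, AddCircle.coe_add, h0, I.coe_dist]
    abel
  rw [this, ← Real.norm_eq_abs]
  exact QuotientAddGroup.norm_mk_le_norm

/-- An estimate of the distance modulo `R` that is accurate enough stays accurate after rounding,
and as a real number. -/
theorem isCloseTo_and_isCloseTo_round {x : X} {v e : ℝ} {l : ℤ}
    (hv : v = I.dist x + e - l * I.R) (he : |e| ≤ 2 / 5) (h0 : 0 ≤ v) (h1 : v ≤ I.R + 1 / 64) :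
    I.IsCloseTo x v ∧ I.IsCloseTo x (round v : ℤ) := by
  have he' := abs_le.1 he
  have hround := abs_le.1 (abs_sub_round v)
  have hl : 1 ≤ I.dist x → I.dist x ≤ I.R - 1 → l = 0 := by
    intro hd1 hd2
    have hR := I.R_pos
    by_contra hne
    rcases lt_or_gt_of_ne hne with h | h
    · have h5 : (l : ℝ) ≤ -1 := by exact_mod_cast (by omega : l ≤ -1)
      have := mul_le_mul_of_nonneg_right h5 hR.le
      linarith
    · have h5 : (1 : ℝ) ≤ l := by exact_mod_cast (by omega : 1 ≤ l)
      have := mul_le_mul_of_nonneg_right h5 hR.le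
      linarith
  refine ⟨⟨(norm_coe_sub_d_le hv).trans (by linarith), fun hd1 hd2 => ?_⟩, ?_, fun hd1 hd2 => ?_⟩
  · rw [hv, hl hd1 hd2, abs_le]
    push_cast
    constructor <;> linarith
  · have hv' : ((round v : ℤ) : ℝ) = I.dist x + (e + ((round v : ℤ) - v)) - l * I.R := by
      linarith
    refine (norm_coe_sub_d_le hv').trans ?_
    rw [abs_le]
    constructor <;> linarith
  · rw [hl hd1 hd2] at hv
    push_cast at hv
    rw [abs_le]
    constructor <;> linarith

set_option maxHeartbeats 800000 in
/-- Two outcomes near their targets with small coprime second components determine the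
distance. -/
theorem succeeds_of_nearTarget (hX : 3 ≤ Nat.card X) {M q : ℕ} {Rhat : ℝ}
    (hE : I.GoodEstimate M Rhat) (hQ : I.GoodMultiplier M q Rhat) {x : X} {K h₁ k₁ h₂ k₂ : ℕ}
    (hK : 6 * K ≤ I.paramB q Rhat) (hk₁ : 1 ≤ k₁) (hk₁' : k₁ ≤ K) (hk₂ : 1 ≤ k₂) (hk₂' : k₂ ≤ K)
    (hcop : Nat.Coprime k₁ k₂) (hh₁ : h₁ < I.paramA M q Rhat) (hh₂ : h₂ < I.paramA M q Rhat)
    (hn₁ : NearTarget (I.paramA M q Rhat)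
      (I.paramA M q Rhat * k₁ * (I.paramN q * I.dist x) / (I.R * I.paramN q)) h₁)
    (hn₂ : NearTarget (I.paramA M q Rhat)
      (I.paramA M q Rhat * k₂ * (I.paramN q * I.dist x) / (I.R * I.paramN q)) h₂) :
    I.Succeeds x (I.paramN q) M Rhat h₁ k₁ h₂ k₂ := by
  have hM2 := hE.two_le
  have hM := hE.hM
  have hR := hE.hR
  have hRabs := hE.abs_sub_le
  have hdm := I.dmin_pos
  have hRp := I.R_pos
  have hcard := I.card_mul_dmin_le
  have hBR := hQ.abs_sub_le hM2
  have hBR4 := abs_le.1 (hQ.abs_sub_le_quarter hM2)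
  have hq1 : (1 : ℝ) ≤ q := by exact_mod_cast hQ.pos
  have hq4 : (q : ℝ) ≤ 4 * M := by exact_mod_cast hQ.le
  have h6 := I.six_mul_le_circumference_mul_paramN hX q
  have hX3 : (3 : ℝ) ≤ Nat.card X := by exact_mod_cast hX
  have hdR : I.dmin ≤ I.R / 3 := by
    have := mul_le_mul_of_nonneg_right hX3 hdm.le
    linarith
  have hMR : (2 : ℝ) ≤ M := by exact_mod_cast hM2
  have hc1 : (1 : ℝ) ≤ I.cmin := by exact_mod_cast I.cmin_pos
  have hNdef : (I.paramN q : ℝ) = q * I.cmin := by unfold paramN; push_cast; ring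
  have hN1 : (1 : ℝ) ≤ I.paramN q := by
    rw [hNdef]; exact one_le_mul_of_one_le_of_one_le hq1 hc1
  have hAdef : (I.paramA M q Rhat : ℝ) = M * I.paramB q Rhat := by unfold paramA; push_cast; ring
  have hKR : 6 * (K : ℝ) ≤ I.paramB q Rhat := by exact_mod_cast hK
  have hK1 : (1 : ℝ) ≤ K := by exact_mod_cast hk₁.trans hk₁'
  have hh₁R : (h₁ : ℝ) ≤ I.paramA M q Rhat := by exact_mod_cast hh₁.le
  have hh₂R : (h₂ : ℝ) ≤ I.paramA M q Rhat := by exact_mod_cast hh₂.le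
  have hd0 := I.dist_nonneg x
  obtain ⟨w₁, hw₁⟩ := hn₁
  obtain ⟨w₂, hw₂⟩ := hn₂
  set N := I.paramN q with hN
  set B := I.paramB q Rhat with hB
  set A := I.paramA M q Rhat with hA
  set d := I.dist x with hd
  have hN0 : (0 : ℝ) < N := by linarith
  have hM0 : (0 : ℝ) < M := by linarith
  have hB0 : (0 : ℝ) < B := by linarith
  have hA0 : (0 : ℝ) < A := by rw [hAdef]; positivity
  -- the Bézout coefficients
  set s := Nat.gcdA k₁ k₂ with hs
  set t := Nat.gcdB k₁ k₂ with ht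
  obtain ⟨hs1, ht1⟩ := Nat.abs_gcdA_le_and_abs_gcdB_le k₁ k₂ hk₂
  rw [max_eq_left hk₁] at ht1
  have hsK : |(s : ℝ)| ≤ K := by
    have : |s| ≤ (K : ℤ) := hs1.trans (by exact_mod_cast hk₂')
    exact_mod_cast this
  have htK : |(t : ℝ)| ≤ K := by
    have : |t| ≤ (K : ℤ) := ht1.trans (by exact_mod_cast hk₁')
    exact_mod_cast this
  have hbez : (s : ℝ) * k₁ + t * k₂ = 1 := by
    have h := Nat.gcd_eq_gcd_ab k₁ k₂
    rw [hcop.gcd_eq_one, ← hs, ← ht] at h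
    have h' : s * k₁ + t * k₂ = 1 := by push_cast at h; linarith
    exact_mod_cast h'
  set θ₁ : ℝ := A * k₁ * (N * d) / (I.R * N) with hθ₁
  set θ₂ : ℝ := A * k₂ * (N * d) / (I.R * N) with hθ₂
  set E : ℝ := s * ((h₁ : ℝ) + w₁ * A - θ₁) + t * ((h₂ : ℝ) + w₂ * A - θ₂) with hEdef
  have hEabs : |E| ≤ 2 * K := by
    refine (abs_add_le _ _).trans ?_
    rw [abs_mul, abs_mul]
    have h1 : |(s : ℝ)| * |(h₁ : ℝ) + w₁ * A - θ₁| ≤ K * 1 := by gcongr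
    have h2 : |(t : ℝ)| * |(h₂ : ℝ) + w₂ * A - θ₂| ≤ K * 1 := by gcongr
    linarith
  set W : ℤ := s * w₁ + t * w₂ with hW
  set H : ℝ := s * h₁ + t * h₂ with hH
  have hHeq : H = A * (d / I.R - W) + E := by
    have h1 : (s : ℝ) * θ₁ + t * θ₂ = A * (d / I.R) := by
      have e1 : θ₁ = k₁ * (A * (d / I.R)) := by rw [hθ₁]; field_simp
      have e2 : θ₂ = k₂ * (A * (d / I.R)) := by rw [hθ₂]; field_simp
      rw [e1, e2]
      linear_combination (A * (d / I.R)) * hbez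
    rw [hH, hEdef, hW]
    push_cast
    linear_combination h1
  have hHabs : |H| ≤ 2 * K * A := by
    refine (abs_add_le _ _).trans ?_
    rw [abs_mul, abs_mul, Nat.abs_cast, Nat.abs_cast]
    have h1 : |(s : ℝ)| * h₁ ≤ K * A := by gcongr
    have h2 : |(t : ℝ)| * h₂ ≤ K * A := by gcongr
    linarith
  -- the target is not far from the origin
  have hdW : |d / I.R - W| ≤ 2 * K + 1 := by
    have h1 : A * |d / I.R - W| ≤ 2 * K * A + 2 * K := by
      rw [← abs_of_pos hA0, ← abs_mul, abs_of_pos hA0]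
      have : A * (d / I.R - W) = H - E := by linarith
      rw [this]
      exact (abs_sub _ _).trans (add_le_add hHabs hEabs)
    have h2 : 2 * (K : ℝ) ≤ A := by
      have : 2 * (B : ℝ) ≤ M * B := by gcongr
      rw [hAdef]; linarith
    by_contra! hlt
    have := mul_lt_mul_of_pos_left hlt hA0
    linarith
  have hNM : 12 ≤ (N : ℝ) * M := by
    have : (N : ℝ) * (2 * I.R + 1) ≤ N * M := by gcongr
    linarith
  set r : ℝ := H / (N * M) with hr
  set ε₁ : ℝ := (B - I.R * N) * (d / I.R - W) / N + E / (N * M) with hε₁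
  have hreq : r = d - W * I.R + ε₁ := by
    rw [hr, hHeq, hAdef, hε₁]
    field_simp
    ring
  have hε₁abs : |ε₁| ≤ 31 / 100 := by
    have h1 : |(B - I.R * N) * (d / I.R - W) / N| ≤ 1 / (2 * M) * (2 * K + 1) / N := by
      rw [abs_div, abs_mul, Nat.abs_cast]
      gcongr
    have h2 : |E / (N * M)| ≤ 2 * K / (N * M) := by
      rw [abs_div, abs_of_pos (show (0 : ℝ) < N * M by positivity)]
      gcongr
    have h3 : 1 / (2 * (M : ℝ)) * (2 * K + 1) / N + 2 * K / (N * M) =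
        (3 * K + 1 / 2) / (N * M) := by field_simp; ring
    refine (abs_add_le _ _).trans ((add_le_add h1 h2).trans ?_)
    rw [h3, div_le_iff₀ (by positivity)]
    have h4 : I.R * N ≤ (M : ℝ) / 2 * N := by gcongr; linarith
    linarith
  set F : ℤ := ⌊r / Rhat⌋ with hF
  have hRabs' := abs_le.1 hRabs
  have hRhat : 99 / 100 * I.R ≤ Rhat := by linarith
  have hRhat0 : 0 < Rhat := by linarith
  have hFabs : |(F : ℝ)| ≤ 3 * K + 1 := by
    have h1 : |r / Rhat| ≤ 3 * K := by
      rw [abs_div, abs_of_pos hRhat0, div_le_iff₀ hRhat0, hr, abs_div,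
        abs_of_pos (show (0 : ℝ) < N * M by positivity), div_le_iff₀ (by positivity)]
      refine hHabs.trans ?_
      rw [hAdef]
      have h2 : (B : ℝ) ≤ 3 / 2 * (Rhat * N) := by
        have : 99 / 100 * I.R * N ≤ Rhat * N := by gcongr
        linarith
      calc 2 * (K : ℝ) * (M * B) ≤ 2 * (K : ℝ) * (M * (3 / 2 * (Rhat * N))) := by gcongr
        _ = _ := by ring
    have h2 := Int.floor_le (r / Rhat)
    have h3 := Int.lt_floor_add_one (r / Rhat)
    have h4 := abs_le.1 h1
    rw [abs_le]
    constructor <;> linarith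
  have hε₂ : |F * (I.R - Rhat)| ≤ 9 / 100 := by
    rw [abs_mul]
    calc |(F : ℝ)| * |I.R - Rhat| ≤ (3 * K + 1) * (1 / (16 * (M : ℝ) ^ 2 * I.cmin)) := by gcongr
      _ ≤ 9 / 100 := by
        rw [mul_one_div, div_le_iff₀ (by positivity)]
        have h1 : I.R * N ≤ M / 2 * (4 * M * I.cmin) := by
          rw [hNdef]
          gcongr
          linarith
        have h2 : (2 : ℝ) ^ 2 * 1 ≤ (M : ℝ) ^ 2 * I.cmin := by gcongr
        linarith
  refine ⟨hcop, ?_⟩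
  have hpost : postProcess N M Rhat h₁ k₁ h₂ k₂ = r - F * Rhat := rfl
  rw [hpost]
  refine isCloseTo_and_isCloseTo_round (e := ε₁ + F * (I.R - Rhat)) (l := W + F) ?_ ?_ ?_ ?_
  · rw [hreq]; push_cast; ring
  · refine (abs_add_le _ _).trans ?_
    linarith
  · have h2 := Int.floor_le (r / Rhat)
    rw [le_div_iff₀ hRhat0] at h2
    linarith
  · have h3 := Int.lt_floor_add_one (r / Rhat)
    rw [div_lt_iff₀ hRhat0] at h3
    have h4 : |I.R - Rhat| ≤ 1 / 64 := by
      refine hR.trans ?_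
      rw [div_le_div_iff₀ (by positivity) (by norm_num)]
      have h2 : (2 : ℝ) ^ 2 * 1 ≤ (M : ℝ) ^ 2 * I.cmin := by gcongr
      linarith
    have h5 := abs_le.1 h4
    linarith

end Infrastructure

namespace Infrastructure

variable {X : Type u} [Finite X] {I : Infrastructure X}

/-! ### The success probability -/

/-- The number of coprime pairs in `[1, K]²`, counted in `ℤ_B × ℤ_B`. -/
theorem sq_le_two_mul_card_coprime_fin {K B : ℕ} (hK : K < B) :
    (K : ℝ) ^ 2 ≤ 2 * ((Finset.univ.filter fun p : Fin B × Fin B =>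
      (1 ≤ (p.1 : ℕ) ∧ (p.1 : ℕ) ≤ K) ∧ (1 ≤ (p.2 : ℕ) ∧ (p.2 : ℕ) ≤ K) ∧
        Nat.Coprime p.1 p.2).card : ℝ) := by
  refine (sq_le_two_mul_card_coprime K).trans ?_
  gcongr
  refine Finset.card_le_card_of_surjOn (fun p : Fin B × Fin B => ((p.1 : ℕ), (p.2 : ℕ))) ?_
  rintro ⟨a, b⟩ hab
  simp only [Finset.coe_filter, Finset.mem_product, Finset.mem_Icc, Set.mem_ofPred_eq] at hab
  obtain ⟨⟨⟨ha1, ha2⟩, hb1, hb2⟩, hc⟩ := hab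
  exact ⟨(⟨a, by omega⟩, ⟨b, by omega⟩), by
    simp only [Finset.coe_filter, Finset.mem_univ, true_and, Set.mem_ofPred_eq]
    exact ⟨⟨ha1, ha2⟩, ⟨hb1, hb2⟩, hc⟩, rfl⟩

open Classical in
/-- If the function that is sampled is correct, two samples succeed with constant probability. -/
theorem EvaluatesCorrectly.le_sum_sampleProb_mul (hX : 3 ≤ Nat.card X) {M q : ℕ} {Rhat : ℝ}
    (hE : I.GoodEstimate M Rhat) (hQ : I.GoodMultiplier M q Rhat) {x : X} {L j : ℕ}
    {g : ℕ → ℕ → X × ℤ} (hg : I.EvaluatesCorrectly x (I.paramA M q Rhat) (I.paramB q Rhat)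
      (I.paramN q) L j g)
    {K : ℕ} (hK : 6 * K ≤ I.paramB q Rhat) {β γ : ℝ}
    (hKβ : 13 / 20 * (K : ℝ) / I.paramB q Rhat ≤ β)
    (hβ : 1 / 4 + 2 * β ≤ 1) (hγ0 : 0 ≤ γ) (hγ : γ ≤ Real.cos (Real.pi * (1 / 4 + 2 * β))) :
    (K : ℝ) ^ 2 / 2 * (γ ^ 2 / (16 * I.paramB q Rhat)) ^ 2 ≤
      ∑ hk₁ : Fin (I.paramA M q Rhat) × Fin (I.paramB q Rhat),
        ∑ hk₂ : Fin (I.paramA M q Rhat) × Fin (I.paramB q Rhat),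
          if I.Succeeds x (I.paramN q) M Rhat hk₁.1 hk₁.2 hk₂.1 hk₂.2 then
            sampleProb (I.paramA M q Rhat) (I.paramB q Rhat) g hk₁ *
              sampleProb (I.paramA M q Rhat) (I.paramB q Rhat) g hk₂
          else 0 := by
  have hM2 := hE.two_le
  have hB6 := hQ.six_mul_le_paramB hX hM2
  have hq := hQ.pos
  have hω := hQ.abs_sub_le_quarter hM2
  have hω6 : 6 ≤ I.R * I.paramN q := by
    have h1 := I.six_mul_le_circumference_mul_paramN hX q
    have h2 : (1 : ℝ) ≤ q := by exact_mod_cast hq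
    linarith
  have hN : 0 < I.paramN q := Nat.mul_pos hq I.cmin_pos
  have hquant := hg.isQuantizedHom hN
  obtain ⟨Y, hY, hYcard⟩ := hg.exists_range hN
  have hA2 : 2 ≤ I.paramA M q Rhat :=
    hM2.trans (Nat.le_mul_of_pos_right _ (by omega))
  have hcard : (Y.card : ℝ) ≤ 2 * (I.paramB q Rhat - 1 : ℕ) := by
    have h1 := I.two_mul_mul_card_le q
    have h2 : (1 : ℝ) ≤ q := by exact_mod_cast hq
    have h3 : 2 * 1 * (Nat.card X : ℝ) ≤ 2 * (q : ℝ) * (Nat.card X : ℝ) := by gcongr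
    have h4 : (6 : ℝ) ≤ I.paramB q Rhat := by exact_mod_cast (by omega : 6 ≤ I.paramB q Rhat)
    have h5 := abs_le.1 hω
    rw [Nat.cast_sub (by omega)]
    push_cast
    linarith
  set B := I.paramB q Rhat with hB
  set A := I.paramA M q Rhat with hA
  set N := I.paramN q with hNdef
  have hB0 : (0 : ℝ) < B := by exact_mod_cast (by omega : 0 < B)
  let θ : Fin B → ℝ := fun k => A * (k : ℕ) * (N * I.dist x) / (I.R * N)
  let f : Fin B → ℝ := fun k =>
    ∑ h ∈ Finset.univ.filter (fun h : Fin A => NearTarget A (θ k) h), sampleProb A B g (h, k)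
  have hf : ∀ k : Fin B, (k : ℕ) ≤ K → γ ^ 2 / (16 * B) ≤ f k := by
    intro k hk
    refine hquant.le_sum_sampleProb hω hω6 hA2 (by omega) Y hY hcard hγ0 (le_trans ?_ hKβ) hβ hγ
      rfl
    have : ((k : ℕ) : ℝ) ≤ K := by exact_mod_cast hk
    gcongr
  let c : Fin B × Fin B → Prop := fun p =>
    (1 ≤ (p.1 : ℕ) ∧ (p.1 : ℕ) ≤ K) ∧ (1 ≤ (p.2 : ℕ) ∧ (p.2 : ℕ) ≤ K) ∧ Nat.Coprime p.1 p.2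
  have hcount := sq_le_two_mul_card_coprime_fin (K := K) (B := B) (by omega)
  have hP : 0 ≤ γ ^ 2 / (16 * (B : ℝ)) := by positivity
  calc (K : ℝ) ^ 2 / 2 * (γ ^ 2 / (16 * B)) ^ 2
      ≤ ((Finset.univ.filter c).card : ℝ) * (γ ^ 2 / (16 * B)) ^ 2 := by
        gcongr
        have : ((Finset.univ.filter c).card : ℝ) = ((Finset.univ.filter fun p : Fin B × Fin B =>
          (1 ≤ (p.1 : ℕ) ∧ (p.1 : ℕ) ≤ K) ∧ (1 ≤ (p.2 : ℕ) ∧ (p.2 : ℕ) ≤ K) ∧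
            Nat.Coprime p.1 p.2).card : ℝ) := by
          congr
        rw [this]
        linarith
    _ ≤ ∑ p ∈ Finset.univ.filter c, f p.1 * f p.2 := by
        rw [← nsmul_eq_mul]
        refine Finset.card_nsmul_le_sum _ _ _ fun p hp => ?_
        obtain ⟨⟨-, h1⟩, ⟨-, h2⟩, -⟩ := (Finset.mem_filter.1 hp).2
        rw [sq]
        exact mul_le_mul (hf _ h1) (hf _ h2) hP (hP.trans (hf _ h1))
    _ = ∑ k₁ : Fin B, ∑ k₂ : Fin B, if c (k₁, k₂) then f k₁ * f k₂ else 0 := by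
        rw [Finset.sum_filter, Fintype.sum_prod_type]
    _ ≤ ∑ k₁ : Fin B, ∑ k₂ : Fin B, ∑ h₁ : Fin A, ∑ h₂ : Fin A,
          if I.Succeeds x N M Rhat h₁ k₁ h₂ k₂ then
            sampleProb A B g (h₁, k₁) * sampleProb A B g (h₂, k₂) else 0 := by
        refine Finset.sum_le_sum fun k₁ _ => Finset.sum_le_sum fun k₂ _ => ?_
        have hnn : ∀ h₁ h₂ : Fin A,
            0 ≤ sampleProb A B g (h₁, k₁) * sampleProb A B g (h₂, k₂) :=
          fun _ _ => mul_nonneg (sampleProb_nonneg _) (sampleProb_nonneg _)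
        split_ifs with hc
        · obtain ⟨⟨hk1, hk1'⟩, ⟨hk2, hk2'⟩, hcop⟩ := hc
          simp only [f]
          rw [Finset.sum_filter, Finset.sum_filter, Finset.sum_mul_sum]
          refine Finset.sum_le_sum fun h₁ _ => Finset.sum_le_sum fun h₂ _ => ?_
          by_cases h1 : NearTarget A (θ k₁) h₁
          · by_cases h2 : NearTarget A (θ k₂) h₂
            · rw [if_pos h1, if_pos h2, if_pos]
              exact succeeds_of_nearTarget hX hE hQ hK hk1 hk1' hk2 hk2' hcop h₁.2 h₂.2 h1 h2
            · rw [if_neg h2, mul_zero]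
              split_ifs
              · exact hnn _ _
              · exact le_rfl
          · rw [if_neg h1, zero_mul]
            split_ifs
            · exact hnn _ _
            · exact le_rfl
        · refine Finset.sum_nonneg fun h₁ _ => Finset.sum_nonneg fun h₂ _ => ?_
          split_ifs
          · exact hnn _ _
          · exact le_rfl
    _ = _ := by
        rw [Fintype.sum_prod_type_right]
        refine Finset.sum_congr rfl fun k₁ _ => ?_
        rw [Finset.sum_comm]
        refine Finset.sum_congr rfl fun h₁ _ => ?_
        rw [Fintype.sum_prod_type_right]

namespace ApproxDist

variable {m : ℕ} (D : I.ApproxDist m)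

theorem evalProb_nonneg (k : ℕ) (dk p : ℝ) (M q : ℕ) (Rhat : ℝ) (x : X) :
    0 ≤ D.evalProb k dk p M q Rhat x := by
  unfold evalProb
  refine mul_nonneg (by positivity) (Finset.sum_nonneg fun j _ => ?_)
  split_ifs <;> norm_num

theorem mul_evalProb_le_successProb (hX : 3 ≤ Nat.card X) {M q : ℕ} {Rhat : ℝ}
    (hE : I.GoodEstimate M Rhat) (hQ : I.GoodMultiplier M q Rhat) (x : X) (k : ℕ) (dk p : ℝ)
    {K : ℕ} (hK : 6 * K ≤ I.paramB q Rhat) {β γ : ℝ}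
    (hKβ : 13 / 20 * (K : ℝ) / I.paramB q Rhat ≤ β)
    (hβ : 1 / 4 + 2 * β ≤ 1) (hγ0 : 0 ≤ γ) (hγ : γ ≤ Real.cos (Real.pi * (1 / 4 + 2 * β))) :
    (K : ℝ) ^ 2 / 2 * (γ ^ 2 / (16 * I.paramB q Rhat)) ^ 2 * D.evalProb k dk p M q Rhat x ≤
      D.successProb k dk p M q Rhat x := by
  unfold evalProb successProb
  rw [mul_left_comm, Finset.mul_sum]
  refine mul_le_mul_of_nonneg_left (Finset.sum_le_sum fun j _ => ?_) (by positivity)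
  split_ifs with hj
  · rw [mul_one]
    exact hj.le_sum_sampleProb_mul hX hE hQ hK hKβ hβ hγ0 hγ
  · rw [mul_zero]
    refine Finset.sum_nonneg fun _ _ => Finset.sum_nonneg fun _ _ => ?_
    split_ifs
    · exact mul_nonneg (sampleProb_nonneg _) (sampleProb_nonneg _)
    · exact le_rfl

end ApproxDist

end Infrastructure

/-! ### Numerical estimates -/

theorem nsinc_three_quarters_lt : nsinc (3 / 4) < 301 / 1000 := by
  have hπ := Real.pi_gt_d2
  have h0 : Real.pi * (3 / 4) ≠ 0 := by positivity
  unfold nsinc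
  rw [Real.sinc_of_ne_zero h0]
  have hsin : Real.sin (Real.pi * (3 / 4)) = Real.sqrt 2 / 2 := by
    rw [← Real.sin_pi_sub, ← Real.sin_pi_div_four]
    congr 1; ring
  rw [hsin, div_lt_iff₀ (by positivity)]
  have h2 : Real.sqrt 2 < 1.4143 := by
    rw [Real.sqrt_lt' (by norm_num)]; norm_num
  nlinarith

theorem sin_pi_div_thirtytwo_gt : 979 / 10000 < Real.sin (Real.pi / 32) := by
  have h1 := Real.pi_gt_d4
  have h2 := Real.pi_lt_d2
  have h0 : 0 < Real.pi / 32 := by positivity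
  have h := Real.sin_gt_sub_cube h0
  have h3 : (Real.pi / 32) ^ 3 ≤ (3.15 / 32) ^ 3 := by gcongr
  norm_num at h3
  linarith

theorem sin_pi_div_thirtytwo_lt : Real.sin (Real.pi / 32) < 1 / 8 := by
  have h2 := Real.pi_lt_d2
  have := Real.sin_lt (x := Real.pi / 32) (by positivity)
  linarith

/-- The admissible range of `κ` is empty unless `q ≥ 8`. -/
theorem eight_le_of_kappa {κ : ℝ} {q : ℕ}
    (h1 : (1 - nsinc (3 / 4)) / (1 - 2 * Real.sin (Real.pi / 32)) < κ)
    (h2 : κ < 1 - 2 / (2 * q + 1)) : 8 ≤ q := by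
  have hs := nsinc_three_quarters_lt
  have hl := sin_pi_div_thirtytwo_gt
  have hu := sin_pi_div_thirtytwo_lt
  have hκ : 869 / 1000 < κ := by
    refine lt_trans ?_ h1
    rw [lt_div_iff₀ (by linarith)]
    linarith
  by_contra! hq
  have hqR : (q : ℝ) ≤ 7 := by exact_mod_cast (by omega : q ≤ 7)
  have : (2 : ℝ) / 15 ≤ 2 / (2 * q + 1) := by
    gcongr; linarith
  linarith

theorem dlogBound_le {κ : ℝ} {q B : ℕ} (hB : 48 ≤ B)
    (h1 : (1 - nsinc (3 / 4)) / (1 - 2 * Real.sin (Real.pi / 32)) < κ)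
    (h2 : κ < 1 - 2 / (2 * q + 1)) : dlogBound κ q B ≤ 5 / 10 ^ 8 := by
  have hs := nsinc_three_quarters_lt
  have hl := sin_pi_div_thirtytwo_gt
  have hu := sin_pi_div_thirtytwo_lt
  have hD : 0 < 1 - 2 * Real.sin (Real.pi / 32) := by linarith
  have hκ0 : 0 < κ := lt_trans (div_pos (by linarith) hD) h1
  have hq : (0 : ℝ) < 2 / (2 * q + 1) := by positivity
  have hκ1 : κ < 1 := by linarith
  have hf1 : (1 - 2 / ((2 * q + 1) * (1 - κ))) ^ 2 ≤ 1 := by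
    have h3 : 2 / ((2 * (q : ℝ) + 1) * (1 - κ)) ≤ 1 := by
      rw [← div_div, div_le_one (by linarith)]
      linarith
    have h4 : 0 ≤ 2 / ((2 * (q : ℝ) + 1) * (1 - κ)) := by
      have : 0 < 1 - κ := by linarith
      positivity
    exact pow_le_one₀ (by linarith) (by linarith)
  have hf2 : κ ^ 2 / 2 ≤ 1 / 2 := by
    have : κ ^ 2 ≤ 1 := pow_le_one₀ hκ0.le hκ1.le
    linarith
  have hf3 : (1 - 2 * Real.sin (Real.pi / 32) - (1 - nsinc (3 / 4)) / κ) ^ 4 ≤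
      (106 / 1000) ^ 4 := by
    have h3 : (1 - nsinc (3 / 4)) / κ ≤ 1 - 2 * Real.sin (Real.pi / 32) := by
      rw [div_le_iff₀ hκ0]
      rw [div_lt_iff₀ hD] at h1
      linarith
    have h4 : 1 - nsinc (3 / 4) ≤ (1 - nsinc (3 / 4)) / κ := by
      rw [le_div_iff₀ hκ0]
      exact mul_le_of_le_one_right (by linarith) hκ1.le
    exact pow_le_pow_left₀ (by linarith) (by linarith) 4
  have hf4 : (1 / 64 - 2 / (B : ℝ)) ^ 2 ≤ (1 / 38) ^ 2 := by
    have hBR : (48 : ℝ) ≤ B := by exact_mod_cast hB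
    have h3 : 2 / (B : ℝ) ≤ 2 / 48 := by gcongr
    have h4 : 0 ≤ 2 / (B : ℝ) := by positivity
    rw [sq_le_sq, abs_of_pos (show (0 : ℝ) < 1 / 38 by norm_num), abs_le]
    constructor <;> linarith
  unfold dlogBound
  calc _ ≤ 1 * (1 / 2) * (106 / 1000 : ℝ) ^ 4 * (1 / 38) ^ 2 := by gcongr
    _ ≤ _ := by norm_num

/-! ### Lower bounds for the success probability -/

theorem mainTheorem3 :
    ∃ (C : ℕ) (c : ℝ), 0 < c ∧
      ∀ (X : Type u) [Finite X] (I : Infrastructure X), 3 ≤ Nat.card X →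
        (∀ (M : ℕ) (Rhat : ℝ), I.GoodEstimate M Rhat → ∃ q, I.GoodMultiplier M q Rhat) ∧
        ∀ (M q : ℕ) (Rhat : ℝ), I.GoodEstimate M Rhat → I.GoodMultiplier M q Rhat →
        ∀ (k : ℕ) (dk : ℝ), I.SpansAtLeast k dk →
        ∀ pg : ℝ, 0 ≤ pg → pg < 1 →
        ∀ m : ℕ, I.paramL M q Rhat k dk pg ^ C ≤ 2 ^ m →
        ∀ (D : I.ApproxDist m) (x : X),
          pg ≤ D.evalProb k dk pg M q Rhat x ∧
          c * D.evalProb k dk pg M q Rhat x ≤ D.successProb k dk pg M q Rhat x ∧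
          ∀ κ : ℝ, (1 - nsinc (3 / 4)) / (1 - 2 * Real.sin (Real.pi / 32)) < κ →
            κ < 1 - 2 / (2 * q + 1) →
            D.evalProb k dk pg M q Rhat x * dlogBound κ q (I.paramB q Rhat) ≤
              D.successProb k dk pg M q Rhat x := by
  have hπ := Real.pi_pos
  set γ : ℝ := Real.cos (Real.pi * (1 / 4 + 2 * (13 / 120))) with hγ
  have hγ0 : 0 < γ := Real.cos_pos_of_mem_Ioo ⟨by linarith, by linarith⟩
  refine ⟨5, γ ^ 4 / 61952, by positivity, fun X _ I hX =>
    ⟨fun M Rhat hE => hE.exists_goodMultiplier hX, ?_⟩⟩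
  intro M q Rhat hE hQ k dk hk pg hpg0 hpg1 m hm D x
  have hB6 := hQ.six_mul_le_paramB hX hE.two_le
  have hq := hQ.pos
  have heval := D.evalProb_nonneg k dk pg M q Rhat x
  refine ⟨D.le_evalProb hX hE hQ hk hpg0 hpg1 hm x, ?_, fun κ hκ1 hκ2 => ?_⟩
  · -- `K = ⌊B / 6⌋` is at least `B / 11`, since `B ≥ 6`
    have hK : 6 * (I.paramB q Rhat / 6) ≤ I.paramB q Rhat := Nat.mul_div_le _ _
    have hK' : I.paramB q Rhat ≤ 11 * (I.paramB q Rhat / 6) := by omega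
    have hB0 : (0 : ℝ) < I.paramB q Rhat := by exact_mod_cast (by omega : 0 < I.paramB q Rhat)
    have hKR : 6 * ((I.paramB q Rhat / 6 : ℕ) : ℝ) ≤ I.paramB q Rhat := by exact_mod_cast hK
    have hKR' : (I.paramB q Rhat : ℝ) ≤ 11 * ((I.paramB q Rhat / 6 : ℕ) : ℝ) := by
      exact_mod_cast hK'
    refine le_trans ?_ (D.mul_evalProb_le_successProb hX hE hQ x k dk pg hK (β := 13 / 120)
      (by rw [div_le_iff₀ hB0]; linarith) (by norm_num) hγ0.le le_rfl)
    gcongr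
    calc γ ^ 4 / 61952 = (I.paramB q Rhat / 11 : ℝ) ^ 2 / 2 *
          (γ ^ 2 / (16 * I.paramB q Rhat)) ^ 2 := by field_simp; norm_num
      _ ≤ _ := by gcongr; linarith
  · -- the bound that depends on `κ` is smaller than the constant obtained from `K = ⌊B / 16⌋`
    have hq8 := eight_le_of_kappa hκ1 hκ2
    have hK : 16 * (I.paramB q Rhat / 16) ≤ I.paramB q Rhat := Nat.mul_div_le _ _
    have hK' : I.paramB q Rhat ≤ 21 * (I.paramB q Rhat / 16) := by omega
    have hB0 : (0 : ℝ) < I.paramB q Rhat := by exact_mod_cast (by omega : 0 < I.paramB q Rhat)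
    have hKR : 16 * ((I.paramB q Rhat / 16 : ℕ) : ℝ) ≤ I.paramB q Rhat := by exact_mod_cast hK
    have hKR' : (I.paramB q Rhat : ℝ) ≤ 21 * ((I.paramB q Rhat / 16 : ℕ) : ℝ) := by
      exact_mod_cast hK'
    refine le_trans ?_ (D.mul_evalProb_le_successProb hX hE hQ x k dk pg
      (K := I.paramB q Rhat / 16) (by omega) (β := 1 / 24) (γ := 1 / 2)
      (by rw [div_le_iff₀ hB0]; linarith) (by norm_num) (by norm_num) ?_)
    · rw [mul_comm]
      gcongr
      refine (dlogBound_le (by omega) hκ1 hκ2).trans ?_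
      calc (5 / 10 ^ 8 : ℝ) ≤ 1 / (2 * 441 * 4096) := by norm_num
        _ = (I.paramB q Rhat / 21 : ℝ) ^ 2 / 2 *
            ((1 / 2) ^ 2 / (16 * I.paramB q Rhat)) ^ 2 := by field_simp; norm_num
        _ ≤ _ := by gcongr; linarith
    · rw [← Real.cos_pi_div_three]
      apply le_of_eq
      congr 1
      ring
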